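/- **Setting.** Fix $0<A<B<1$. On a probability space $(\Omega,\mathcal P)$ let $(a_n,b_n)_{n\ge1}$ be i.i.d. random pairs with $A\le\min(a_n,b_n)$ and $a_n+b_n\le B$, and let $(p_n)_{n\ge1}$ be i.i.d. random variables in $[0,1]$, independent of $(a_n,b_n)_{n\ge1}$, such that, for some $t>0$, $\mathbb E(a_n^{-t})$, $\mathbb E(b_n^{-t})$, $\mathbb E(p_n^{-t})$ and $\mathbb E((1-p_n)^{-t})$ are finite (where $0^{-t}=\infty$). For $\omega\in\Omega$ start with the single step-$0$ interval $[0,1]$ and replace each interval $I$ of step $n-1$ by two children, the leftmost closed subinterval of $I$ of length $a_n(\omega)|I|$ and the rightmost closed subinterval of $I$ of length $b_n(\omega)|I|$. Let $C_\omega$ be the intersection over $n$ of the unions of the intervals of step $n$, and let $\mu_\omega$ be the Borel probability measure on $C_\omega$ such that every interval $I$ of step $n-1$ has a left child of $\mu_\omega$-measure $p_n(\omega)\mu_\omega(I)$ and a right child of measure $(1-p_n(\omega))\mu_\omega(I)$. **Dimensions.** A dimension function is a map $\Phi:(0,1)\to[0,\infty)$ such that $t^{1+\Phi(t)}$ decreases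 (weakly) to $0$ as $t$ decreases to $0$. It is *small* if $\Phi(t)=H(t)\,\frac{\log|\log t|}{|\log t|}$ for all $t$ near $0$, where $H(t)\to0$ as $t\to0^+$. The upper $\Phi$-dimension $\overline{\dim}_\Phi\mu$ is the infimum of all $d\in\mathbb R$ for which there are $C_1,C_2>0$ such that $$\frac{\mu(B(x,R))}{\mu(B(x,r))}\le C_2\Big(\frac Rr\Big)^d\quad\text{whenever } 0<r<R^{1+\Phi(R)}\le R\le C_1,\ R<1,\ x\in\operatorname{supp}\mu$$ (with $\inf\emptyset=\infty$; balls are open), and the lower $\Phi$-dimension $\underline{\dim}_\Phi\mu$ is the supremum of all $d\in\mathbb R$ for which the same holds with $\ge$ in place of $\le$ in the displayed inequality between the ratios. **Theorem.** Let $$a_0=\operatorname{ess\,inf}a_1,\quad b_0=\operatorname{ess\,inf}b_1,\quad A_0=\operatorname{ess\,sup}a_1,\quad B_0=\operatorname{ess\,sup}b_1,$$ $$p_0=\operatorname{ess\,sup}p_1,\quad q_0=\operatorname{ess\,sup}(1-p_1),\quad P_0=\operatorname{ess\,inf}p_1,\quad Q_0=\operatorname{ess\,inf}(1-p_1),$$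 and put $$\alpha=\max\Big(\frac{\log P_0}{\log A_0},\frac{\log Q_0}{\log B_0}\Big),\qquad \beta=\min\Big(\frac{\log p_0}{\log a_0},\frac{\log q_0}{\log b_0}\Big),$$ where $\alpha=\infty$ if $P_0=0$ or $Q_0=0$. Then there is a measurable set $\Gamma\subseteq\Omega$ with $\mathcal P(\Gamma)=1$ such that $\overline{\dim}_\Phi\mu_\omega=\alpha$ and $\underline{\dim}_\Phi\mu_\omega=\beta$ for all $\omega\in\Gamma$ and all small dimension functions $\Phi$. -/

import Mathlib

open MeasureTheory ProbabilityTheory Filter Topology Set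

/-! ### Dimension functions and Phi-dimensions of measures -/

/-- A dimension function is a map `Φ : (0,1) → [0,∞)` such that `t ^ (1 + Φ t)` decreases to `0` as
`t` decreases to `0`. Only the values of `Φ` on `(0,1)` matter. -/
structure IsDimensionFunction (Φ : ℝ → ℝ) : Prop where
  nonneg : ∀ t ∈ Ioo (0 : ℝ) 1, 0 ≤ Φ t
  mono : MonotoneOn (fun t : ℝ => t ^ (1 + Φ t)) (Ioo 0 1)
  tendsto_zero : Tendsto (fun t : ℝ => t ^ (1 + Φ t)) (𝓝[>] 0) (𝓝 0)

/-- `Φ` is small if, near `0`, `Φ t = H t * log |log t| / |log t|` with `H t → 0` as `t → 0+`. -/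
def IsSmallDimensionFunction (Φ : ℝ → ℝ) : Prop :=
  IsDimensionFunction Φ ∧ ∃ H : ℝ → ℝ, Tendsto H (𝓝[>] 0) (𝓝 0) ∧
    ∀ᶠ t in 𝓝[>] (0 : ℝ), Φ t = H t * (Real.log |Real.log t| / |Real.log t|)

section PhiDimension

variable {X : Type*} [PseudoMetricSpace X] [MeasurableSpace X]

/-- The upper `Φ`-dimension of a measure, with value `⊤` if no exponent is admissible. -/
noncomputable def upperPhiDim (Φ : ℝ → ℝ) (μ : Measure X) : EReal :=
  sInf ((fun d : ℝ => (d : EReal)) '' {d : ℝ | ∃ C₁ > (0 : ℝ), ∃ C₂ > (0 : ℝ), ∀ r R : ℝ,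
    0 < r → r < R ^ (1 + Φ R) → R ^ (1 + Φ R) ≤ R → R ≤ C₁ → R < 1 → ∀ x ∈ μ.support,
      μ (Metric.ball x R) / μ (Metric.ball x r) ≤ ENNReal.ofReal (C₂ * (R / r) ^ d)})

/-- The lower `Φ`-dimension of a measure. -/
noncomputable def lowerPhiDim (Φ : ℝ → ℝ) (μ : Measure X) : EReal :=
  sSup ((fun d : ℝ => (d : EReal)) '' {d : ℝ | ∃ C₁ > (0 : ℝ), ∃ C₂ > (0 : ℝ), ∀ r R : ℝ,
    0 < r → r < R ^ (1 + Φ R) → R ^ (1 + Φ R) ≤ R → R ≤ C₁ → R < 1 → ∀ x ∈ μ.support,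
      ENNReal.ofReal (C₂ * (R / r) ^ d) ≤ μ (Metric.ball x R) / μ (Metric.ball x r)})

end PhiDimension

/-! ### Moran sets and Moran measures

An infinite word `v : ℕ → Bool` codes a branch of the construction: `v n = false` means that the
left child is chosen at step `n + 1`, and `v n = true` that the right child is chosen. The entries
`a n`, `b n`, `p n` are the data used at step `n + 1`. -/

/-- Length of the Moran interval of step `n` along `v`. -/
def moranLength (a b : ℕ → ℝ) (v : ℕ → Bool) : ℕ → ℝ
  | 0 => 1
  | n + 1 => moranLength a b v n * (if v n then b n else a n)

/-- Left endpoint of the Moran interval of step `n` along `v`: the left child shares the left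
endpoint of its parent, and the right child shares the right endpoint. -/
def moranLeft (a b : ℕ → ℝ) (v : ℕ → Bool) : ℕ → ℝ
  | 0 => 0
  | n + 1 => moranLeft a b v n +
      (if v n then moranLength a b v n - moranLength a b v (n + 1) else 0)

/-- The Moran interval of step `n` along `v`. -/
def moranInterval (a b : ℕ → ℝ) (v : ℕ → Bool) (n : ℕ) : Set ℝ :=
  Icc (moranLeft a b v n) (moranLeft a b v n + moranLength a b v n)

/-- The Moran set. -/
def moranSet (a b : ℕ → ℝ) : Set ℝ := ⋂ n, ⋃ v, moranInterval a b v n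

/-- The point of the Moran set coded by `v`: the limit of the left endpoints. -/
noncomputable def moranPoint (a b : ℕ → ℝ) (v : ℕ → Bool) : ℝ := ⨆ n, moranLeft a b v n

/-- The Moran measure: the image under the coding map of the product of the measures giving mass
`p n` to the left child and `1 - p n` to the right child. It is the measure on the Moran set in
which every Moran interval of step `n` passes the proportion `p n` of its mass to its left child and
`1 - p n` to its right child, see `moranMeasure_leftChild` and `moranMeasure_rightChild`. -/
noncomputable def moranMeasure (a b : ℕ → ℝ) (p : ℕ → unitInterval) : Measure ℝ :=
  (Measure.infinitePi fun n => bernoulliMeasure false true (p n)).map (moranPoint a b)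

section Facts

theorem moranLength_congr (a b : ℕ → ℝ) {v w : ℕ → Bool} {n : ℕ} (h : ∀ i < n, w i = v i) :
    moranLength a b w n = moranLength a b v n := by
  induction n with
  | zero => rfl
  | succ n ih =>
    simp only [moranLength]
    rw [ih fun i hi => h i (by omega), h n (by omega)]

theorem moranLeft_congr (a b : ℕ → ℝ) {v w : ℕ → Bool} {n : ℕ} (h : ∀ i < n, w i = v i) :
    moranLeft a b w n = moranLeft a b v n := by
  induction n with
  | zero => rfl
  | succ n ih =>
    simp only [moranLeft]
    rw [ih fun i hi => h i (by omega), h n (by omega), moranLength_congr a b h,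
      moranLength_congr a b fun i hi => h i (Nat.lt_succ_of_lt hi)]

theorem moranLength_pos {a b : ℕ → ℝ} (ha : ∀ n, 0 < a n) (hb : ∀ n, 0 < b n)
    (v : ℕ → Bool) (n : ℕ) : 0 < moranLength a b v n := by
  induction n with
  | zero => simp [moranLength]
  | succ n ih =>
    simp only [moranLength]
    split_ifs
    · exact mul_pos ih (hb n)
    · exact mul_pos ih (ha n)

theorem moranInterval_step {a b : ℕ → ℝ} (ha : ∀ n, 0 < a n) (hb : ∀ n, 0 < b n)
    (hab : ∀ n, a n + b n < 1) (v : ℕ → Bool) (n : ℕ) :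
    moranLeft a b v n ≤ moranLeft a b v (n + 1) ∧
    moranLeft a b v (n + 1) + moranLength a b v (n + 1) ≤
      moranLeft a b v n + moranLength a b v n := by
  have h := moranLength_pos ha hb v n
  have := ha n
  have := hb n
  have := hab n
  simp only [moranLeft, moranLength]
  split_ifs <;> constructor <;> nlinarith

theorem moranLeft_mono {a b : ℕ → ℝ} (ha : ∀ n, 0 < a n) (hb : ∀ n, 0 < b n)
    (hab : ∀ n, a n + b n < 1) (v : ℕ → Bool) : Monotone (moranLeft a b v) :=
  monotone_nat_of_le_succ fun n => (moranInterval_step ha hb hab v n).1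

theorem moranInterval_anti {a b : ℕ → ℝ} (ha : ∀ n, 0 < a n) (hb : ∀ n, 0 < b n)
    (hab : ∀ n, a n + b n < 1) (v : ℕ → Bool) : Antitone (moranInterval a b v) :=
  antitone_nat_of_succ_le fun n =>
    Icc_subset_Icc (moranInterval_step ha hb hab v n).1 (moranInterval_step ha hb hab v n).2

theorem moranLeft_le {a b : ℕ → ℝ} (ha : ∀ n, 0 < a n) (hb : ∀ n, 0 < b n)
    (hab : ∀ n, a n + b n < 1) (v : ℕ → Bool) (n m : ℕ) :
    moranLeft a b v m ≤ moranLeft a b v n + moranLength a b v n := by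
  have h1 : moranLeft a b v (max n m) ∈ moranInterval a b v n :=
    moranInterval_anti ha hb hab v (le_max_left n m)
      ⟨le_rfl, by linarith [moranLength_pos ha hb v (max n m)]⟩
  exact (moranLeft_mono ha hb hab v (le_max_right n m)).trans h1.2

theorem moranPoint_mem {a b : ℕ → ℝ} (ha : ∀ n, 0 < a n) (hb : ∀ n, 0 < b n)
    (hab : ∀ n, a n + b n < 1) (v : ℕ → Bool) (n : ℕ) : moranPoint a b v ∈ moranInterval a b v n :=
  ⟨le_ciSup (f := moranLeft a b v)
      ⟨_, by rintro _ ⟨m, rfl⟩; exact moranLeft_le ha hb hab v n m⟩ n,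
    ciSup_le fun m => moranLeft_le ha hb hab v n m⟩

theorem moranPoint_mem_iff {a b : ℕ → ℝ} (ha : ∀ n, 0 < a n) (hb : ∀ n, 0 < b n)
    (hab : ∀ n, a n + b n < 1) (v w : ℕ → Bool) (n : ℕ) :
    moranPoint a b w ∈ moranInterval a b v n ↔ ∀ i < n, w i = v i := by
  constructor
  · induction n with
    | zero => intro _ i hi; omega
    | succ n ih =>
      intro h
      have hn := ih (moranInterval_anti ha hb hab v (Nat.le_succ n) h)
      have hw := moranPoint_mem ha hb hab w (n + 1)
      have e1 := moranLength_congr a b hn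
      have e2 := moranLeft_congr a b hn
      have hp := moranLength_pos ha hb v n
      have := mul_pos hp (sub_pos.2 (hab n))
      intro i hi
      rcases Nat.lt_succ_iff_lt_or_eq.1 hi with hi | rfl
      · exact hn i hi
      · simp only [moranInterval, moranLeft, moranLength, mem_Icc, e1, e2] at h hw
        cases hv : v i <;> cases hwi : w i <;> simp only [hv, hwi] at h hw ⊢ <;>
          simp at h hw <;> nlinarith
  · intro h
    have := moranPoint_mem ha hb hab w n
    rwa [moranInterval, moranLeft_congr a b h, moranLength_congr a b h] at this

theorem measurable_moranLength (a b : ℕ → ℝ) (n : ℕ) :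
    Measurable fun v => moranLength a b v n := by
  induction n with
  | zero => exact measurable_const
  | succ n ih =>
    exact ih.mul ((measurable_of_finite fun c : Bool => if c then b n else a n).comp
      (measurable_pi_apply n))

theorem measurable_moranLeft (a b : ℕ → ℝ) (n : ℕ) : Measurable fun v => moranLeft a b v n := by
  induction n with
  | zero => exact measurable_const
  | succ n ih =>
    exact ih.add (Measurable.ite (measurableSet_eq_fun (measurable_pi_apply n) measurable_const)
      ((measurable_moranLength a b n).sub (measurable_moranLength a b (n + 1))) measurable_const)

theorem measurable_moranPoint (a b : ℕ → ℝ) : Measurable (moranPoint a b) :=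
  Measurable.iSup fun n => measurable_moranLeft a b n

instance (a b : ℕ → ℝ) (p : ℕ → unitInterval) : IsProbabilityMeasure (moranMeasure a b p) :=
  Measure.isProbabilityMeasure_map (measurable_moranPoint a b).aemeasurable

theorem moranMeasure_moranInterval {a b : ℕ → ℝ} (ha : ∀ n, 0 < a n) (hb : ∀ n, 0 < b n)
    (hab : ∀ n, a n + b n < 1) (p : ℕ → unitInterval) (v : ℕ → Bool) (n : ℕ) :
    moranMeasure a b p (moranInterval a b v n) =
      ∏ i ∈ Finset.range n, ENNReal.ofReal (if v i then 1 - (p i : ℝ) else p i) := by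
  rw [moranMeasure, Measure.map_apply (s := moranInterval a b v n) (measurable_moranPoint a b)
    measurableSet_Icc]
  have : moranPoint a b ⁻¹' moranInterval a b v n =
      Set.pi (Finset.range n : Set ℕ) fun i => {v i} := by
    ext w
    simp [moranPoint_mem_iff ha hb hab, Set.mem_pi]
  rw [this, Measure.infinitePi_pi _ fun i _ => measurableSet_singleton _]
  refine Finset.prod_congr rfl fun i _ => ?_
  classical
  rw [bernoulliMeasure_apply _ (measurableSet_singleton _)]
  have h (q : unitInterval) : (unitInterval.toNNReal q : ENNReal) = ENNReal.ofReal q := by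
    rw [← ENNReal.ofReal_coe_nnreal]
    rfl
  cases v i <;> simp [h]

/-- The left child of a Moran interval gets the proportion `p n` of the mass. -/
theorem moranMeasure_leftChild {a b : ℕ → ℝ} (ha : ∀ n, 0 < a n) (hb : ∀ n, 0 < b n)
    (hab : ∀ n, a n + b n < 1) (p : ℕ → unitInterval) (v : ℕ → Bool) (n : ℕ) (hv : v n = false) :
    moranMeasure a b p (moranInterval a b v (n + 1)) =
      ENNReal.ofReal (p n) * moranMeasure a b p (moranInterval a b v n) := by
  simp [moranMeasure_moranInterval ha hb hab, Finset.prod_range_succ, hv, mul_comm]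

/-- The right child of a Moran interval gets the proportion `1 - p n` of the mass. -/
theorem moranMeasure_rightChild {a b : ℕ → ℝ} (ha : ∀ n, 0 < a n) (hb : ∀ n, 0 < b n)
    (hab : ∀ n, a n + b n < 1) (p : ℕ → unitInterval) (v : ℕ → Bool) (n : ℕ) (hv : v n = true) :
    moranMeasure a b p (moranInterval a b v (n + 1)) =
      ENNReal.ofReal (1 - p n) * moranMeasure a b p (moranInterval a b v n) := by
  simp [moranMeasure_moranInterval ha hb hab, Finset.prod_range_succ, hv, mul_comm]

theorem measurableSet_moranSet (a b : ℕ → ℝ) : MeasurableSet (moranSet a b) := by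
  refine MeasurableSet.iInter fun n => ?_
  have : ⋃ v, moranInterval a b v n = ⋃ u : Fin n → Bool,
      moranInterval a b (fun i => if h : i < n then u ⟨i, h⟩ else false) n := by
    refine Subset.antisymm (iUnion_subset fun v => ?_)
      (iUnion_subset fun u => subset_iUnion (fun v => moranInterval a b v n) _)
    refine Subset.trans (Eq.subset ?_) (subset_iUnion _ fun i : Fin n => v i)
    have h : ∀ i < n, v i = if h : i < n then v i else false := fun i hi => by simp [hi]
    rw [moranInterval, moranInterval, moranLeft_congr a b h, moranLength_congr a b h]
  rw [this]
  exact MeasurableSet.iUnion fun u => measurableSet_Icc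

/-- The Moran measure is concentrated on the Moran set. -/
theorem moranMeasure_moranSet {a b : ℕ → ℝ} (ha : ∀ n, 0 < a n) (hb : ∀ n, 0 < b n)
    (hab : ∀ n, a n + b n < 1) (p : ℕ → unitInterval) :
    moranMeasure a b p (moranSet a b) = 1 := by
  rw [moranMeasure, Measure.map_apply (measurable_moranPoint a b) (measurableSet_moranSet a b)]
  have : moranPoint a b ⁻¹' moranSet a b = univ := eq_univ_of_forall fun v =>
    mem_iInter.2 fun n => mem_iUnion.2 ⟨v, moranPoint_mem ha hb hab v n⟩
  rw [this, measure_univ]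

end Facts

/-!
The gaps between the intervals of a Moran set have lengths comparable to the intervals themselves.
Hence, up to constants, the ratio of the measures of two concentric balls `B(x, R)`, `B(x, r)` is a
product of inverse weights along the word coding `x`, while `R / r` is the product of the inverse
ratios along the same steps (`MoranRatios.mass_le_ball`, `MoranRatios.ball_le_mass`).

If at every step and for either child the weight is at least the `d`-th power of the ratio, then `d`
is admissible for the upper dimension, and with the opposite inequality it is admissible for the
lower dimension (`MoranRatios.ball_div_ball_le`, `MoranRatios.le_ball_div_ball`). Almost surely this
applies to `d = α` and to `d = β`, whatever the dimension function is.

These exponents are optimal because of long runs of nearly extremal data. By the second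
Borel-Cantelli lemma, there are almost surely infinitely many `n` such that the data of the steps
from `n` to `n + c log n` are all nearly extremal (`ae_hasLogRuns`). A small dimension function
requires `r < R |log R| ^ (-o(1))` only; at scales `R` of step `n`, where `|log R|` is of order `n`,
this is a passage of `o(log n)` steps, so that such a run contains an admissible pair of radii
(`IsSmallDimensionFunction.eventually_lt_rpow`). Along the leftmost or the rightmost branch, the run
compares the `d`-th power of an extremal ratio with an extremal weight
(`MoranRatios.le_of_run_of_upper`, `MoranRatios.le_of_run_of_lower`). Runs with rational thresholds
suffice, so that one event of full measure serves all dimension functions.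
-/

/-! ### Geometry of Moran sets -/

/-- Ratios of a Moran construction: each child keeps at least the proportion `A` of its parent, and
the two children together at most the proportion `B < 1`. -/
structure MoranRatios (A B : ℝ) (a b : ℕ → ℝ) : Prop where
  pos : 0 < A
  lt_one : B < 1
  le_left : ∀ n, A ≤ a n
  le_right : ∀ n, A ≤ b n
  add_le : ∀ n, a n + b n ≤ B

/-- The ratio of the child `c` at step `n + 1`. -/
def childRatio (a b : ℕ → ℝ) (c : Bool) (n : ℕ) : ℝ := if c then b n else a n

/-- The proportion of mass of the child `c` at step `n + 1`. -/
def childWeight (p : ℕ → unitInterval) (c : Bool) (n : ℕ) : ℝ :=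
  if c then 1 - (p n : ℝ) else p n

/-- The mass of the Moran interval of step `n` along `v`. -/
noncomputable def moranMass (p : ℕ → unitInterval) (v : ℕ → Bool) (n : ℕ) : ℝ :=
  ∏ i ∈ Finset.range n, childWeight p (v i) i

theorem moranLength_succ (a b : ℕ → ℝ) (v : ℕ → Bool) (n : ℕ) :
    moranLength a b v (n + 1) = moranLength a b v n * childRatio a b (v n) n := rfl

theorem moranMass_succ (p : ℕ → unitInterval) (v : ℕ → Bool) (n : ℕ) :
    moranMass p v (n + 1) = moranMass p v n * childWeight p (v n) n :=
  Finset.prod_range_succ _ _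

theorem moranMass_pos {p : ℕ → unitInterval} (hp : ∀ c n, 0 < childWeight p c n) (v : ℕ → Bool)
    (n : ℕ) : 0 < moranMass p v n :=
  Finset.prod_pos fun _ _ => hp _ _

namespace MoranRatios

variable {A B : ℝ} {a b : ℕ → ℝ} (h : MoranRatios A B a b)

include h

theorem left_pos (n : ℕ) : 0 < a n := h.pos.trans_le (h.le_left n)

theorem right_pos (n : ℕ) : 0 < b n := h.pos.trans_le (h.le_right n)

theorem add_lt (n : ℕ) : a n + b n < 1 := (h.add_le n).trans_lt h.lt_one

theorem le_childRatio (c : Bool) (n : ℕ) : A ≤ childRatio a b c n := by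
  cases c
  · exact h.le_left n
  · exact h.le_right n

theorem childRatio_le (c : Bool) (n : ℕ) : childRatio a b c n ≤ B := by
  have := h.add_le n
  have := h.left_pos n
  have := h.right_pos n
  cases c <;> simp only [childRatio] <;> simp <;> linarith

theorem childRatio_pos (c : Bool) (n : ℕ) : 0 < childRatio a b c n :=
  h.pos.trans_le (h.le_childRatio c n)

theorem A_le_B : A ≤ B := (h.le_childRatio false 0).trans (h.childRatio_le false 0)

theorem B_pos : 0 < B := h.pos.trans_le h.A_le_B

theorem length_pos (v : ℕ → Bool) (n : ℕ) : 0 < moranLength a b v n :=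
  moranLength_pos h.left_pos h.right_pos v n

theorem length_antitone (v : ℕ → Bool) : Antitone (moranLength a b v) :=
  antitone_nat_of_succ_le fun n => by
    rw [moranLength_succ]
    exact mul_le_of_le_one_right (h.length_pos v n).le ((h.childRatio_le _ _).trans h.lt_one.le)

theorem length_le_pow (v : ℕ → Bool) (n : ℕ) : moranLength a b v n ≤ B ^ n := by
  induction n with
  | zero => simp [moranLength]
  | succ n ih =>
    rw [moranLength_succ, pow_succ]
    exact mul_le_mul ih (h.childRatio_le _ _) (h.childRatio_pos _ _).le (pow_nonneg h.B_pos.le _)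

theorem pow_le_length (v : ℕ → Bool) (n : ℕ) : A ^ n ≤ moranLength a b v n := by
  induction n with
  | zero => simp [moranLength]
  | succ n ih =>
    rw [moranLength_succ, pow_succ]
    exact mul_le_mul ih (h.le_childRatio _ _) h.pos.le (h.length_pos v n).le

theorem tendsto_length (v : ℕ → Bool) : Tendsto (moranLength a b v) atTop (𝓝 0) :=
  squeeze_zero (fun n => (h.length_pos v n).le) (h.length_le_pow v)
    (tendsto_pow_atTop_nhds_zero_of_lt_one h.B_pos.le h.lt_one)

theorem point_mem (v : ℕ → Bool) (n : ℕ) : moranPoint a b v ∈ moranInterval a b v n :=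
  moranPoint_mem h.left_pos h.right_pos h.add_lt v n

theorem point_mem_of_eq {v w : ℕ → Bool} {n : ℕ} (hvw : ∀ i < n, w i = v i) :
    moranPoint a b w ∈ moranInterval a b v n :=
  (moranPoint_mem_iff h.left_pos h.right_pos h.add_lt v w n).2 hvw

theorem abs_sub_point_le {v w : ℕ → Bool} {n : ℕ} (hvw : ∀ i < n, w i = v i) :
    |moranPoint a b w - moranPoint a b v| ≤ moranLength a b v n := by
  have h1 := h.point_mem_of_eq hvw
  have h2 := h.point_mem v n
  rw [abs_le]
  constructor <;> linarith [h1.1, h1.2, h2.1, h2.2]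

/-- The gap between the two children of an interval separates the points of the Moran set: two
points whose codes differ before step `n` are at distance at least `(1 - B)` times the length of the
last common interval. -/
theorem exists_le_abs_sub_point {v w : ℕ → Bool} {n : ℕ} (hvw : ¬ ∀ i < n, w i = v i) :
    ∃ k < n, (1 - B) * moranLength a b v k ≤ |moranPoint a b w - moranPoint a b v| := by
  classical
  have hex : ∃ i, w i ≠ v i := by
    push Not at hvw
    obtain ⟨i, _, hi⟩ := hvw
    exact ⟨i, hi⟩
  have hmin : ∀ i < Nat.find hex, w i = v i := fun i hi => by
    simpa using Nat.find_min hex hi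
  set k := Nat.find hex with hk
  have hne : w k ≠ v k := Nat.find_spec hex
  refine ⟨k, ?_, ?_⟩
  · by_contra! hnk
    exact hvw fun i hi => hmin i (hi.trans_le hnk)
  · have h1 := h.point_mem v (k + 1)
    have h2 := h.point_mem w (k + 1)
    have e1 := moranLength_congr a b hmin
    have e2 := moranLeft_congr a b hmin
    have hp := h.length_pos v k
    have := mul_le_mul_of_nonneg_left (h.add_le k) hp.le
    simp only [moranInterval, moranLeft, moranLength, mem_Icc, e1, e2] at h1 h2
    cases hv : v k <;> cases hw : w k <;> simp only [hv, hw] at h1 h2 hne <;>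
      simp at h1 h2 hne
    · exact le_abs.2 (Or.inl (by nlinarith))
    · exact le_abs.2 (Or.inr (by nlinarith))

theorem continuous_moranPoint : Continuous (moranPoint a b) := by
  refine continuous_iff_continuousAt.2 fun v => Metric.tendsto_nhds.2 fun ε hε => ?_
  obtain ⟨n, hn⟩ := ((h.tendsto_length v).eventually (gt_mem_nhds hε)).exists
  have : ∀ᶠ w in 𝓝 v, ∀ i ∈ Finset.range n, w i = v i :=
    (Finset.eventually_all _).2 fun i _ =>
      (continuous_apply i).continuousAt.preimage_mem_nhds ((isOpen_discrete {v i}).mem_nhds rfl)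
  filter_upwards [this] with w hw
  rw [Real.dist_eq]
  exact (h.abs_sub_point_le fun i hi => hw i (Finset.mem_range.2 hi)).trans_lt hn

/-- Every point of the support of a Moran measure is coded by a word, since the set of coded points
is compact and carries the measure. -/
theorem exists_point_eq {p : ℕ → unitInterval} {x : ℝ} (hx : x ∈ (moranMeasure a b p).support) :
    ∃ v, moranPoint a b v = x := by
  have hc : IsClosed (range (moranPoint a b)) :=
    (isCompact_range h.continuous_moranPoint).isClosed
  refine Measure.support_subset_of_isClosed hc ?_ hx
  exact (ae_map_iff (measurable_moranPoint a b).aemeasurable hc.measurableSet).2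
    (ae_of_all _ fun v => mem_range_self v)

theorem measure_interval (p : ℕ → unitInterval) (v : ℕ → Bool) (n : ℕ) :
    moranMeasure a b p (moranInterval a b v n) = ENNReal.ofReal (moranMass p v n) := by
  rw [moranMeasure_moranInterval h.left_pos h.right_pos h.add_lt, moranMass,
    ENNReal.ofReal_prod_of_nonneg]
  · rfl
  · intro i _
    have h1 := (p i).2.1
    have h2 := (p i).2.2
    unfold childWeight
    split_ifs <;> linarith

/-- A ball whose radius exceeds the length of the interval of step `n` contains that interval. -/
theorem mass_le_ball (p : ℕ → unitInterval) {v : ℕ → Bool} {n : ℕ} {r : ℝ}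
    (hr : moranLength a b v n < r) :
    ENNReal.ofReal (moranMass p v n) ≤ moranMeasure a b p (Metric.ball (moranPoint a b v) r) := by
  rw [← h.measure_interval]
  refine measure_mono fun y hy => ?_
  have h2 := h.point_mem v n
  rw [Metric.mem_ball, Real.dist_eq, abs_lt]
  constructor <;> linarith [hy.1, hy.2, h2.1, h2.2]

/-- A ball whose radius is at most the gaps around the intervals of step at most `n` meets the Moran
set in the interval of step `n` only. -/
theorem ball_le_mass (p : ℕ → unitInterval) {v : ℕ → Bool} {n : ℕ} {r : ℝ}
    (hr : ∀ k < n, r ≤ (1 - B) * moranLength a b v k) :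
    moranMeasure a b p (Metric.ball (moranPoint a b v) r) ≤ ENNReal.ofReal (moranMass p v n) := by
  rw [← h.measure_interval, moranMeasure, Measure.map_apply (measurable_moranPoint a b)
    Metric.isOpen_ball.measurableSet, Measure.map_apply (s := moranInterval a b v n)
    (measurable_moranPoint a b) measurableSet_Icc]
  refine measure_mono fun w hw => ?_
  rw [mem_preimage, Metric.mem_ball, Real.dist_eq] at hw
  refine h.point_mem_of_eq ?_
  by_contra hne
  obtain ⟨k, hk, hle⟩ := h.exists_le_abs_sub_point hne
  linarith [hr k hk]

theorem point_mem_support {p : ℕ → unitInterval} (hp : ∀ c n, 0 < childWeight p c n)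
    (v : ℕ → Bool) : moranPoint a b v ∈ (moranMeasure a b p).support := by
  refine Metric.nhds_basis_ball.mem_measureSupport.2 fun r hr => ?_
  obtain ⟨n, hn⟩ := ((h.tendsto_length v).eventually (gt_mem_nhds hr)).exists
  exact (ENNReal.ofReal_pos.2 (moranMass_pos hp v n)).trans_le (h.mass_le_ball p hn)

theorem monotone_mass_div {p : ℕ → unitInterval} (hp : ∀ c n, 0 < childWeight p c n) {d : ℝ}
    (hd : ∀ c n, childRatio a b c n ^ d ≤ childWeight p c n) (v : ℕ → Bool) :
    Monotone fun n => moranMass p v n / moranLength a b v n ^ d :=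
  monotone_nat_of_le_succ fun n => by
    have h1 := moranMass_pos hp v n
    have h2 := h.length_pos v n
    have h3 := h.childRatio_pos (v n) n
    rw [moranMass_succ, moranLength_succ, Real.mul_rpow h2.le h3.le, mul_div_mul_comm]
    exact le_mul_of_one_le_right (by positivity) ((one_le_div (by positivity)).2 (hd _ _))

theorem antitone_mass_div {p : ℕ → unitInterval} (hp : ∀ c n, 0 < childWeight p c n) {d : ℝ}
    (hd : ∀ c n, childWeight p c n ≤ childRatio a b c n ^ d) (v : ℕ → Bool) :
    Antitone fun n => moranMass p v n / moranLength a b v n ^ d :=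
  antitone_nat_of_succ_le fun n => by
    have h1 := moranMass_pos hp v n
    have h2 := h.length_pos v n
    have h3 := h.childRatio_pos (v n) n
    rw [moranMass_succ, moranLength_succ, Real.mul_rpow h2.le h3.le, mul_div_mul_comm]
    exact mul_le_of_le_one_right (by positivity) ((div_le_one (by positivity)).2 (hd _ _))

theorem exists_length_lt (v : ℕ → Bool) {r : ℝ} (hr : 0 < r) (C : ℝ) :
    ∃ n, C * moranLength a b v n < r ∧ ∀ k < n, r ≤ C * moranLength a b v k := by
  classical
  have hex : ∃ n, C * moranLength a b v n < r := by
    have : Tendsto (fun n => C * moranLength a b v n) atTop (𝓝 0) := by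
      simpa using (h.tendsto_length v).const_mul C
    exact (this.eventually (gt_mem_nhds hr)).exists
  exact ⟨Nat.find hex, Nat.find_spec hex, fun k hk => not_lt.1 (Nat.find_min hex hk)⟩

theorem mul_le_length {v : ℕ → Bool} {n : ℕ} {r : ℝ} (hr : r ≤ 1)
    (hn : ∀ k < n, r ≤ moranLength a b v k) : A * r ≤ moranLength a b v n := by
  have hA1 : A < 1 := h.A_le_B.trans_lt h.lt_one
  cases n with
  | zero =>
    simp only [moranLength]
    nlinarith [h.pos]
  | succ n =>
    rw [moranLength_succ, mul_comm]
    exact mul_le_mul (hn n (Nat.lt_succ_self n)) (h.le_childRatio _ _) h.pos.le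
      (h.length_pos v n).le

/-- If the weights dominate the `d`-th powers of the ratios, then `d` bounds the growth of the
measure of balls from above. -/
theorem ball_div_ball_le {p : ℕ → unitInterval} (hp : ∀ c n, 0 < childWeight p c n) {d : ℝ}
    (hd0 : 0 ≤ d) (hd : ∀ c n, childRatio a b c n ^ d ≤ childWeight p c n) {r R : ℝ} (hr : 0 < r)
    (hrR : r ≤ R) (hR : R ≤ 1) {x : ℝ} (hx : x ∈ (moranMeasure a b p).support) :
    moranMeasure a b p (Metric.ball x R) / moranMeasure a b p (Metric.ball x r) ≤
      ENNReal.ofReal ((1 / ((1 - B) * A)) ^ d * (R / r) ^ d) := by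
  obtain ⟨v, rfl⟩ := h.exists_point_eq hx
  have hB : 0 < 1 - B := sub_pos.2 h.lt_one
  have hA := h.pos
  have hR0 := hr.trans_le hrR
  obtain ⟨N, hN, hN'⟩ := h.exists_length_lt v hR0 (1 - B)
  obtain ⟨m, hm, hm'⟩ := h.exists_length_lt v hr 1
  simp only [one_mul] at hm hm'
  have hNm : N ≤ m := by
    by_contra! hlt
    have := hN' m hlt
    nlinarith [h.length_pos v m, h.B_pos]
  have hlm := h.mul_le_length (hrR.trans hR) hm'
  have hmono := h.monotone_mass_div hp hd v hNm
  have hlN := h.length_pos v N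
  have hlm0 := h.length_pos v m
  have hMN := moranMass_pos hp v N
  have hMm := moranMass_pos hp v m
  refine (ENNReal.div_le_div (h.ball_le_mass p hN') (h.mass_le_ball p hm)).trans ?_
  rw [← ENNReal.ofReal_div_of_pos hMm]
  refine ENNReal.ofReal_le_ofReal ?_
  rw [← Real.mul_rpow (by positivity) (by positivity)]
  calc moranMass p v N / moranMass p v m ≤ (moranLength a b v N / moranLength a b v m) ^ d := by
        rw [Real.div_rpow hlN.le hlm0.le, div_le_div_iff₀ hMm (by positivity)]
        simp only at hmono
        rw [div_le_div_iff₀ (by positivity) (by positivity)] at hmono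
        linarith
    _ ≤ _ := by
        refine Real.rpow_le_rpow (by positivity) ?_ hd0
        rw [div_mul_div_comm, one_mul, div_le_div_iff₀ hlm0 (by positivity)]
        calc moranLength a b v N * ((1 - B) * A * r)
            = ((1 - B) * moranLength a b v N) * (A * r) := by ring
          _ ≤ R * moranLength a b v m := by gcongr

/-- If the weights are dominated by the `d`-th powers of the ratios, then `d` bounds the growth of
the measure of balls from below. -/
theorem le_ball_div_ball {p : ℕ → unitInterval} (hp : ∀ c n, 0 < childWeight p c n) {d : ℝ}
    (hd0 : 0 ≤ d) (hd : ∀ c n, childWeight p c n ≤ childRatio a b c n ^ d) {r R : ℝ} (hr : 0 < r)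
    (hrR : r ≤ R) (hR : R ≤ 1) {x : ℝ} (hx : x ∈ (moranMeasure a b p).support) :
    ENNReal.ofReal (((1 - B) * A) ^ d * (R / r) ^ d) ≤
      moranMeasure a b p (Metric.ball x R) / moranMeasure a b p (Metric.ball x r) := by
  obtain ⟨v, rfl⟩ := h.exists_point_eq hx
  have hB : 0 < 1 - B := sub_pos.2 h.lt_one
  have hA := h.pos
  have hR0 := hr.trans_le hrR
  obtain ⟨N, hN, hN'⟩ := h.exists_length_lt v hR0 1
  obtain ⟨m, hm, hm'⟩ := h.exists_length_lt v hr (1 - B)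
  simp only [one_mul] at hN hN'
  have hlN := h.length_pos v N
  have hlm0 := h.length_pos v m
  have hMN := moranMass_pos hp v N
  have hMm := moranMass_pos hp v m
  rw [← Real.mul_rpow (by positivity) (by positivity)]
  rcases le_or_gt N m with hNm | hmN
  · have hlN' := h.mul_le_length hR hN'
    have hmono := h.antitone_mass_div hp hd v hNm
    refine le_trans ?_ (ENNReal.div_le_div (h.mass_le_ball p hN) (h.ball_le_mass p hm'))
    rw [← ENNReal.ofReal_div_of_pos hMm]
    refine ENNReal.ofReal_le_ofReal ?_
    calc ((1 - B) * A * (R / r)) ^ d ≤ (moranLength a b v N / moranLength a b v m) ^ d := by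
          refine Real.rpow_le_rpow (by positivity) ?_ hd0
          rw [← mul_div_assoc, div_le_div_iff₀ hr hlm0]
          calc (1 - B) * A * R * moranLength a b v m
              = (A * R) * ((1 - B) * moranLength a b v m) := by ring
            _ ≤ moranLength a b v N * r := by gcongr
      _ ≤ _ := by
          rw [Real.div_rpow hlN.le hlm0.le, div_le_div_iff₀ (by positivity) hMm]
          simp only at hmono
          rw [div_le_div_iff₀ (by positivity) (by positivity)] at hmono
          linarith
  · -- The two radii are comparable, and the larger ball contains the smaller one.
    have h1 := hN' m hmN
    have h2 : (1 - B) * A * (R / r) ≤ 1 := by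
      have hA1 : A ≤ 1 := (h.A_le_B.trans_lt h.lt_one).le
      rw [← mul_div_assoc, div_le_one hr]
      calc (1 - B) * A * R ≤ (1 - B) * 1 * moranLength a b v m := by gcongr
        _ ≤ r := by linarith
    have hball : moranMeasure a b p (Metric.ball (moranPoint a b v) r) ≠ 0 :=
      ((Metric.nhds_basis_ball.mem_measureSupport.1 hx) r hr).ne'
    calc ENNReal.ofReal (((1 - B) * A * (R / r)) ^ d) ≤ 1 := by
          rw [← ENNReal.ofReal_one]
          exact ENNReal.ofReal_le_ofReal (Real.rpow_le_one (by positivity) h2 hd0)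
      _ = _ := (ENNReal.div_self hball (measure_ne_top _ _)).symm
      _ ≤ _ := ENNReal.div_le_div_right (measure_mono (Metric.ball_subset_ball hrR)) _

end MoranRatios

/-! ### Long runs of nearly extremal data -/

/-- `G` holds on infinitely many blocks `[n, n + c * log n)`, for some `c > 0`. -/
def HasLogRuns (G : ℕ → Prop) : Prop :=
  ∃ c > (0 : ℝ), ∃ᶠ n : ℕ in atTop, ∀ k : ℕ, n ≤ k → (k : ℝ) < n + c * Real.log n → G k

theorem IsDimensionFunction.rpow_le {Φ : ℝ → ℝ} (hΦ : IsDimensionFunction Φ) {R : ℝ}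
    (hR : R ∈ Ioo (0 : ℝ) 1) : R ^ (1 + Φ R) ≤ R := by
  simpa using Real.rpow_le_rpow_of_exponent_ge hR.1 hR.2.le
    (le_add_of_nonneg_right (hΦ.nonneg R hR) : (1 : ℝ) ≤ 1 + Φ R)

/-- A small dimension function changes the scale `R` only by a factor `|log R| ^ (-o(1))`. At the
scales `R` of the intervals of step `n`, a block of `c * log n` further steps therefore reaches
below `R ^ (1 + Φ R)`. -/
theorem IsSmallDimensionFunction.eventually_lt_rpow {Φ : ℝ → ℝ} (hΦ : IsSmallDimensionFunction Φ)
    {A B : ℝ} (hA : 0 < A) (hB0 : 0 < B) (hB1 : B < 1) {ℓ : ℕ → ℝ} (hl : ∀ n, A ^ n ≤ ℓ n)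
    (hu : ∀ n, ℓ n ≤ B ^ n) {c K₁ K₂ : ℝ} (hc : 0 < c) (hK₁ : 0 < K₁) (hK₂ : 0 < K₂) :
    ∀ᶠ n : ℕ in atTop, ∀ r : ℝ, ∀ L : ℕ, c * Real.log n ≤ L → r ≤ K₂ * B ^ L * ℓ n →
      r < (K₁ * ℓ n) ^ (1 + Φ (K₁ * ℓ n)) := by
  obtain ⟨-, H, hH, hΦH⟩ := hΦ
  have hℓ : ∀ n, 0 < ℓ n := fun n => (pow_pos hA n).trans_le (hl n)
  have hR0 : Tendsto (fun n => K₁ * ℓ n) atTop (𝓝 0) := by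
    have : Tendsto ℓ atTop (𝓝 0) := squeeze_zero (fun n => (hℓ n).le) hu
      (tendsto_pow_atTop_nhds_zero_of_lt_one hB0.le hB1)
    simpa using this.const_mul K₁
  have hR : Tendsto (fun n => K₁ * ℓ n) atTop (𝓝[>] 0) :=
    tendsto_nhdsWithin_iff.2 ⟨hR0, Eventually.of_forall fun n => mul_pos hK₁ (hℓ n)⟩
  have hlogB : 0 < -Real.log B := neg_pos.2 (Real.log_neg hB0 hB1)
  -- A block of `L` steps shrinks lengths by `B ^ L ≤ exp (-8 ε log n)`, while
  -- `R ^ Φ R = exp (-H R log |log R|) ≥ exp (-2 ε log n)` once `|H R| ≤ ε` and `|log R| ≤ n ^ 2`.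
  set ε : ℝ := c * (-Real.log B) / 8 with hε
  have hε0 : 0 < ε := by positivity
  have hlog : Tendsto (fun n : ℕ => Real.log n) atTop atTop :=
    Real.tendsto_log_atTop.comp tendsto_natCast_atTop_atTop
  filter_upwards [hR.eventually hΦH,
    (hH.comp hR).abs.eventually (gt_mem_nhds (show |(0 : ℝ)| < ε by simpa using hε0)),
    (Real.tendsto_log_nhdsGT_zero.comp hR).eventually (eventually_le_atBot (-1)),
    hlog.eventually (eventually_gt_atTop (Real.log (K₂ / K₁) / (6 * ε))),
    tendsto_natCast_atTop_atTop.eventually (eventually_ge_atTop (|Real.log K₁| + |Real.log A|)),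
    eventually_ge_atTop 1] with n h1 h2 h3 h4 h5 h6 r L hL hr
  have hRn : 0 < K₁ * ℓ n := mul_pos hK₁ (hℓ n)
  have hn1 : (1 : ℝ) ≤ n := by exact_mod_cast h6
  have hlogn : 0 ≤ Real.log n := Real.log_nonneg hn1
  simp only [Function.comp_apply] at h2 h3
  set R := K₁ * ℓ n with hRdef
  have habs : |Real.log R| = -Real.log R := abs_of_neg (by linarith)
  have hle : -Real.log R ≤ (n : ℝ) ^ 2 := by
    have e1 : Real.log R = Real.log K₁ + Real.log (ℓ n) := Real.log_mul hK₁.ne' (hℓ n).ne'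
    have e2 : n * Real.log A ≤ Real.log (ℓ n) := by
      rw [← Real.log_pow]
      exact Real.log_le_log (pow_pos hA n) (hl n)
    have e3 := neg_abs_le (Real.log K₁)
    have e4 := neg_abs_le (Real.log A)
    have e5 := abs_nonneg (Real.log K₁)
    have e6 := abs_nonneg (Real.log A)
    nlinarith
  have hLL0 : 0 ≤ Real.log |Real.log R| := Real.log_nonneg (by rw [habs]; linarith)
  have hLL : Real.log |Real.log R| ≤ 2 * Real.log n := by
    have := Real.log_le_log (by linarith : 0 < -Real.log R) hle
    rw [Real.log_pow] at this
    rw [habs]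
    exact_mod_cast this
  have hpow : R ^ (1 + Φ R) = R * Real.exp (-(H R * Real.log |Real.log R|)) := by
    rw [Real.rpow_add hRn, Real.rpow_one, Real.rpow_def_of_pos hRn, h1, habs]
    congr 2
    have : Real.log R ≠ 0 := by linarith
    field_simp
  have hexp : Real.exp (-(2 * ε * Real.log n)) ≤ Real.exp (-(H R * Real.log |Real.log R|)) := by
    refine Real.exp_le_exp.2 (neg_le_neg ?_)
    calc H R * Real.log |Real.log R| ≤ |H R| * Real.log |Real.log R| := by
          gcongr
          exact le_abs_self _
      _ ≤ ε * (2 * Real.log n) := by gcongr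
      _ = _ := by ring
  have hBL : B ^ L ≤ Real.exp (-(8 * ε * Real.log n)) := by
    rw [← Real.exp_log (pow_pos hB0 L), Real.log_pow]
    refine Real.exp_le_exp.2 ?_
    rw [hε]
    nlinarith
  have hK : K₂ / K₁ < Real.exp (6 * ε * Real.log n) := by
    rw [← Real.log_lt_iff_lt_exp (by positivity)]
    rwa [div_lt_iff₀' (by positivity)] at h4
  rw [hpow]
  calc r ≤ K₂ * B ^ L * ℓ n := hr
    _ = R * (K₂ / K₁ * B ^ L) := by rw [hRdef]; field_simp
    _ ≤ R * (K₂ / K₁ * Real.exp (-(8 * ε * Real.log n))) := by gcongr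
    _ < R * (Real.exp (6 * ε * Real.log n) * Real.exp (-(8 * ε * Real.log n))) := by gcongr
    _ = R * Real.exp (-(2 * ε * Real.log n)) := by rw [← Real.exp_add]; ring_nf
    _ ≤ _ := by gcongr

theorem pow_run_le {u s : ℕ → ℝ} (hu : ∀ n, 0 ≤ u n) (hs : ∀ n, u (n + 1) = u n * s n) {q : ℝ}
    (hq : 0 ≤ q) {n L : ℕ} (h : ∀ k, n ≤ k → k < n + L → s k ≤ q) :
    u (n + L) ≤ u n * q ^ L := by
  induction L with
  | zero => simp
  | succ L ih =>
    rw [← add_assoc, hs, pow_succ, ← mul_assoc]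
    exact (mul_le_mul_of_nonneg_left (h _ (by omega) (by omega)) (hu _)).trans
      (mul_le_mul_of_nonneg_right (ih fun k h1 h2 => h k h1 (by omega)) hq)

theorem le_pow_run {u s : ℕ → ℝ} (hu : ∀ n, 0 ≤ u n) (hs : ∀ n, u (n + 1) = u n * s n) {q : ℝ}
    (hq : 0 ≤ q) {n L : ℕ} (h : ∀ k, n ≤ k → k < n + L → q ≤ s k) :
    u n * q ^ L ≤ u (n + L) := by
  induction L with
  | zero => simp
  | succ L ih =>
    rw [← add_assoc, hs, pow_succ, ← mul_assoc]
    exact (mul_le_mul_of_nonneg_right (ih fun k h1 h2 => h k h1 (by omega)) hq).trans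
      (mul_le_mul_of_nonneg_left (h _ (by omega) (by omega)) (hu _))

theorem HasLogRuns.mono {G G' : ℕ → Prop} (hG : HasLogRuns G) (h : ∀ k, G k → G' k) :
    HasLogRuns G' := by
  obtain ⟨c, hc, hf⟩ := hG
  exact ⟨c, hc, hf.mono fun n hn k h1 h2 => h k (hn k h1 h2)⟩

theorem HasLogRuns.frequently {G : ℕ → Prop} (hG : HasLogRuns G) :
    ∃ c > (0 : ℝ), ∃ᶠ n : ℕ in atTop, ∀ k : ℕ, n ≤ k → k < n + ⌈c * Real.log n⌉₊ → G k := by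
  obtain ⟨c, hc, hf⟩ := hG
  refine ⟨c, hc, hf.mono fun n hn k h1 h2 => hn k h1 ?_⟩
  have : k - n < ⌈c * Real.log n⌉₊ := by omega
  rw [Nat.lt_ceil, Nat.cast_sub h1] at this
  linarith

namespace MoranRatios

variable {A B : ℝ} {a b : ℕ → ℝ} (h : MoranRatios A B a b)

include h

/-- Test of an admissible exponent of the upper dimension at the endpoint coded by the constant word
`e`. For a run of `L` steps from step `n` on, the ball of radius twice the length of the interval of
step `n` contains this interval, and the ball whose radius is the gap of step `n + L` carries at most
the mass of the interval of that step. The ratio of masses is at least `π⁻¹ ^ L`, the ratio of radii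
at most a constant times `lam⁻¹ ^ L`. -/
theorem le_of_run_of_upper {p : ℕ → unitInterval} (hp : ∀ c n, 0 < childWeight p c n)
    {Φ : ℝ → ℝ} (hΦ : IsSmallDimensionFunction Φ) {d C₁ C₂ : ℝ} (hd : 0 ≤ d) (hC₁ : 0 < C₁)
    (hadm : ∀ r R : ℝ, 0 < r → r < R ^ (1 + Φ R) → R ^ (1 + Φ R) ≤ R → R ≤ C₁ → R < 1 →
      ∀ x ∈ (moranMeasure a b p).support,
        moranMeasure a b p (Metric.ball x R) / moranMeasure a b p (Metric.ball x r) ≤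
          ENNReal.ofReal (C₂ * (R / r) ^ d))
    (e : Bool) {π lam : ℝ} (hπ : 0 < π) (hlam : 0 < lam)
    (hrun : HasLogRuns fun k => childWeight p e k ≤ π ∧ lam ≤ childRatio a b e k) :
    lam ^ d ≤ π := by
  by_contra! hlt
  obtain ⟨c, hc, hf⟩ := hrun.frequently
  set ℓ := moranLength a b fun _ => e with hℓ
  have hℓ0 : ∀ n, 0 < ℓ n := h.length_pos _
  have hM0 : ∀ n, 0 < moranMass p (fun _ => e) n := moranMass_pos hp _
  have hB : 0 < 1 - B := sub_pos.2 h.lt_one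
  have hq : 1 < lam ^ d / π := (one_lt_div hπ).2 hlt
  have hlog : Tendsto (fun n : ℕ => ⌈c * Real.log n⌉₊) atTop atTop :=
    tendsto_nat_ceil_atTop.comp ((Real.tendsto_log_atTop.comp
      tendsto_natCast_atTop_atTop).const_mul_atTop hc)
  have hR : Tendsto (fun n => 2 * ℓ n) atTop (𝓝 0) := by
    simpa using (h.tendsto_length fun _ => e).const_mul 2
  obtain ⟨n, hn, h1, h2, h3, h4⟩ := (hf.and_eventually
    ((hΦ.eventually_lt_rpow h.pos h.B_pos h.lt_one (h.pow_le_length fun _ => e)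
      (h.length_le_pow fun _ => e) hc two_pos hB).and
    (((tendsto_pow_atTop_atTop_of_one_lt hq).comp hlog).eventually
      (eventually_gt_atTop (C₂ * (2 / (1 - B)) ^ d)) |>.and
    ((hR.eventually (ge_mem_nhds hC₁)).and (hR.eventually (gt_mem_nhds one_pos)))))).exists
  set L := ⌈c * Real.log n⌉₊ with hL
  have hmass : moranMass p (fun _ => e) (n + L) ≤ moranMass p (fun _ => e) n * π ^ L :=
    pow_run_le (fun n => (hM0 n).le) (moranMass_succ p _) hπ.le fun k hk hk' => (hn k hk hk').1
  have hlen : ℓ n * lam ^ L ≤ ℓ (n + L) :=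
    le_pow_run (fun n => (hℓ0 n).le) (moranLength_succ a b _) hlam.le
      fun k hk hk' => (hn k hk hk').2
  have hlen' : ℓ (n + L) ≤ ℓ n * B ^ L :=
    pow_run_le (fun n => (hℓ0 n).le) (moranLength_succ a b _) h.B_pos.le
      fun k hk hk' => h.childRatio_le _ _
  have hRn : 0 < 2 * ℓ n := mul_pos two_pos (hℓ0 n)
  have hr : 0 < (1 - B) * ℓ (n + L) := mul_pos hB (hℓ0 _)
  have key := hadm ((1 - B) * ℓ (n + L)) (2 * ℓ n) hr
    (h1 _ L (Nat.le_ceil _) (by rw [mul_assoc, mul_comm (B ^ L)]; gcongr))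
    (hΦ.1.rpow_le ⟨hRn, h4⟩) h3 h4 _ (h.point_mem_support hp fun _ => e)
  have key2 := (ENNReal.div_le_div (h.mass_le_ball p (v := fun _ => e) (n := n)
    (r := 2 * ℓ n) (by linarith [hℓ0 n])) (h.ball_le_mass p (v := fun _ => e) (n := n + L)
    (r := (1 - B) * ℓ (n + L)) fun k hk =>
      mul_le_mul_of_nonneg_left (h.length_antitone _ hk.le) hB.le)).trans key
  rw [← ENNReal.ofReal_div_of_pos (hM0 _)] at key2
  have hpos : 0 < moranMass p (fun _ => e) n / moranMass p (fun _ => e) (n + L) :=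
    div_pos (hM0 _) (hM0 _)
  have key3 := (ENNReal.ofReal_le_ofReal_iff' .. ).1 key2 |>.resolve_right (not_le.2 hpos)
  -- A nonpositive constant would make the upper bound of a positive ratio nonpositive.
  have hC₂ : 0 < C₂ := by
    by_contra! hC
    have := hpos.trans_le key3
    have h0 : 0 ≤ (2 * ℓ n / ((1 - B) * ℓ (n + L))) ^ d := by positivity
    nlinarith
  have e1 : (2 * ℓ n / ((1 - B) * ℓ (n + L))) ^ d ≤ (2 / (1 - B)) ^ d / (lam ^ d) ^ L := by
    rw [Real.rpow_pow_comm hlam.le, ← Real.div_rpow (by positivity) (by positivity)]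
    refine Real.rpow_le_rpow (by positivity) ?_ hd
    rw [div_div, div_le_div_iff₀ hr (by positivity)]
    calc 2 * ℓ n * ((1 - B) * lam ^ L) = 2 * (1 - B) * (ℓ n * lam ^ L) := by ring
      _ ≤ 2 * (1 - B) * ℓ (n + L) := by gcongr
      _ = _ := by ring
  have e2 : 1 / π ^ L ≤ moranMass p (fun _ => e) n / moranMass p (fun _ => e) (n + L) := by
    rw [div_le_div_iff₀ (by positivity) (hM0 _)]
    linarith
  have e3 : 1 / π ^ L ≤ C₂ * ((2 / (1 - B)) ^ d / (lam ^ d) ^ L) :=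
    e2.trans (key3.trans (by gcongr))
  simp only [Function.comp_apply, div_pow] at h2
  rw [lt_div_iff₀ (by positivity)] at h2
  rw [← mul_div_assoc, div_le_div_iff₀ (by positivity) (by positivity)] at e3
  linarith

/-- Test of an admissible exponent of the lower dimension at the endpoint coded by the constant word
`e`, with the roles of the two kinds of radii in `le_of_run_of_upper` exchanged. -/
theorem le_of_run_of_lower {p : ℕ → unitInterval} (hp : ∀ c n, 0 < childWeight p c n)
    {Φ : ℝ → ℝ} (hΦ : IsSmallDimensionFunction Φ) {d C₁ C₂ : ℝ} (hd : 0 ≤ d) (hC₁ : 0 < C₁)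
    (hC₂ : 0 < C₂)
    (hadm : ∀ r R : ℝ, 0 < r → r < R ^ (1 + Φ R) → R ^ (1 + Φ R) ≤ R → R ≤ C₁ → R < 1 →
      ∀ x ∈ (moranMeasure a b p).support,
        ENNReal.ofReal (C₂ * (R / r) ^ d) ≤
          moranMeasure a b p (Metric.ball x R) / moranMeasure a b p (Metric.ball x r))
    (e : Bool) {π lam : ℝ} (hπ : 0 < π) (hlam : 0 < lam)
    (hrun : HasLogRuns fun k => π ≤ childWeight p e k ∧ childRatio a b e k ≤ lam) :
    π ≤ lam ^ d := by
  by_contra! hlt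
  obtain ⟨c, hc, hf⟩ := hrun.frequently
  set ℓ := moranLength a b fun _ => e with hℓ
  have hℓ0 : ∀ n, 0 < ℓ n := h.length_pos _
  have hM0 : ∀ n, 0 < moranMass p (fun _ => e) n := moranMass_pos hp _
  have hB : 0 < 1 - B := sub_pos.2 h.lt_one
  have hlamd : 0 < lam ^ d := Real.rpow_pos_of_pos hlam d
  have hq : 1 < π / lam ^ d := (one_lt_div hlamd).2 hlt
  have hlog : Tendsto (fun n : ℕ => ⌈c * Real.log n⌉₊) atTop atTop :=
    tendsto_nat_ceil_atTop.comp ((Real.tendsto_log_atTop.comp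
      tendsto_natCast_atTop_atTop).const_mul_atTop hc)
  have hR : Tendsto (fun n => (1 - B) * ℓ n) atTop (𝓝 0) := by
    simpa using (h.tendsto_length fun _ => e).const_mul (1 - B)
  obtain ⟨n, hn, h1, h2, h3, h4⟩ := (hf.and_eventually
    ((hΦ.eventually_lt_rpow h.pos h.B_pos h.lt_one (h.pow_le_length fun _ => e)
      (h.length_le_pow fun _ => e) hc hB two_pos).and
    (((tendsto_pow_atTop_atTop_of_one_lt hq).comp hlog).eventually
      (eventually_gt_atTop (1 / (C₂ * ((1 - B) / 2) ^ d))) |>.and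
    ((hR.eventually (ge_mem_nhds hC₁)).and (hR.eventually (gt_mem_nhds one_pos)))))).exists
  set L := ⌈c * Real.log n⌉₊ with hL
  have hmass : moranMass p (fun _ => e) n * π ^ L ≤ moranMass p (fun _ => e) (n + L) :=
    le_pow_run (fun n => (hM0 n).le) (moranMass_succ p _) hπ.le fun k hk hk' => (hn k hk hk').1
  have hlen : ℓ (n + L) ≤ ℓ n * lam ^ L :=
    pow_run_le (fun n => (hℓ0 n).le) (moranLength_succ a b _) hlam.le
      fun k hk hk' => (hn k hk hk').2
  have hlen' : ℓ (n + L) ≤ ℓ n * B ^ L :=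
    pow_run_le (fun n => (hℓ0 n).le) (moranLength_succ a b _) h.B_pos.le
      fun k hk hk' => h.childRatio_le _ _
  have hRn : 0 < (1 - B) * ℓ n := mul_pos hB (hℓ0 n)
  have hr : 0 < 2 * ℓ (n + L) := mul_pos two_pos (hℓ0 _)
  have key := hadm (2 * ℓ (n + L)) ((1 - B) * ℓ n) hr
    (h1 _ L (Nat.le_ceil _) (by rw [mul_assoc, mul_comm (B ^ L)]; gcongr))
    (hΦ.1.rpow_le ⟨hRn, h4⟩) h3 h4 _ (h.point_mem_support hp fun _ => e)
  have key2 := key.trans (ENNReal.div_le_div (h.ball_le_mass p (v := fun _ => e) (n := n)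
    (r := (1 - B) * ℓ n) fun k hk => mul_le_mul_of_nonneg_left (h.length_antitone _ hk.le) hB.le)
    (h.mass_le_ball p (v := fun _ => e) (n := n + L) (r := 2 * ℓ (n + L))
      (by linarith [hℓ0 (n + L)])))
  rw [← ENNReal.ofReal_div_of_pos (hM0 _)] at key2
  have key3 := (ENNReal.ofReal_le_ofReal_iff (div_pos (hM0 _) (hM0 _)).le).1 key2
  have e1 : ((1 - B) / 2) ^ d / (lam ^ d) ^ L ≤ ((1 - B) * ℓ n / (2 * ℓ (n + L))) ^ d := by
    rw [Real.rpow_pow_comm hlam.le, ← Real.div_rpow (by positivity) (by positivity)]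
    refine Real.rpow_le_rpow (by positivity) ?_ hd
    rw [div_div, div_le_div_iff₀ (by positivity) hr]
    calc (1 - B) * (2 * ℓ (n + L)) ≤ (1 - B) * (2 * (ℓ n * lam ^ L)) := by gcongr
      _ = _ := by ring
  have e2 : moranMass p (fun _ => e) n / moranMass p (fun _ => e) (n + L) ≤ 1 / π ^ L := by
    rw [div_le_div_iff₀ (hM0 _) (by positivity)]
    linarith
  have e3 : C₂ * (((1 - B) / 2) ^ d / (lam ^ d) ^ L) ≤ 1 / π ^ L :=
    le_trans (by gcongr) (key3.trans e2)
  simp only [Function.comp_apply, div_pow] at h2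
  rw [div_lt_div_iff₀ (by positivity) (by positivity)] at h2
  rw [← mul_div_assoc, div_le_div_iff₀ (by positivity) (by positivity)] at e3
  linarith

end MoranRatios

/-! ### Almost sure existence of long runs -/

section Runs

variable {Ω : Type*} [MeasurableSpace Ω] {P : Measure Ω}

theorem iIndepSet_preimage_inter_preimage {β γ : Type*} [MeasurableSpace β] [MeasurableSpace γ]
    {Z : ℕ → Ω → β} {Y : ℕ → Ω → γ} (hZm : ∀ n, Measurable (Z n)) (hYm : ∀ n, Measurable (Y n))
    (hZ : iIndepFun Z P) (hY : iIndepFun Y P)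
    (hZY : IndepFun (fun ω n => Z n ω) (fun ω n => Y n ω) P) {V : Set β} {U : Set γ}
    (hV : MeasurableSet V) (hU : MeasurableSet U) :
    iIndepSet (fun n => Z n ⁻¹' V ∩ Y n ⁻¹' U) P := by
  have key : ∀ S : Finset ℕ, P (⋂ i ∈ S, Z i ⁻¹' V ∩ Y i ⁻¹' U) =
      (∏ i ∈ S, P (Z i ⁻¹' V)) * ∏ i ∈ S, P (Y i ⁻¹' U) := by
    intro S
    rw [← hZ.measure_inter_preimage_eq_mul S (sets := fun _ => V) fun _ _ => hV,
      ← hY.measure_inter_preimage_eq_mul S (sets := fun _ => U) fun _ _ => hU]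
    have := hZY.measure_inter_preimage_eq_mul (⋂ i ∈ S, Function.eval i ⁻¹' V)
      (⋂ i ∈ S, Function.eval i ⁻¹' U)
      (S.measurableSet_biInter fun i _ => measurable_pi_apply i hV)
      (S.measurableSet_biInter fun i _ => measurable_pi_apply i hU)
    simp only [preimage_iInter] at this
    refine Eq.trans (congrArg P ?_) this
    ext ω
    simp [forall_and]
  refine (iIndepSet_iff_meas_biInter fun n => (hZm n hV).inter (hYm n hU)).2 fun S => ?_
  rw [key, ← Finset.prod_mul_distrib]
  refine Finset.prod_congr rfl fun i _ => ?_
  simpa using (key {i}).symm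

/-- Independent events of equal positive probability occur, almost surely, along infinitely many
blocks `[n, n + c * log n)`. The blocks starting at the squares `(j + 1) ^ 2` are disjoint, and
their probabilities dominate a harmonic series if `c` is small, so that the second Borel-Cantelli
lemma applies. -/
theorem ae_hasLogRuns [IsProbabilityMeasure P] {E : ℕ → Set Ω} (hEm : ∀ n, MeasurableSet (E n))
    (hE : iIndepSet E P) {δ : ENNReal} (hδ : 0 < δ) (hPE : ∀ n, P (E n) = δ) :
    ∀ᵐ ω ∂P, HasLogRuns fun k => ω ∈ E k := by
  have hδ1 : δ ≤ 1 := hPE 0 ▸ prob_le_one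
  have hδt : δ ≠ ⊤ := (hδ1.trans_lt ENNReal.one_lt_top).ne
  set D := δ.toReal with hD
  have hD0 : 0 < D := ENNReal.toReal_pos hδ.ne' hδt
  have hD1 : D ≤ 1 := by simpa using ENNReal.toReal_mono ENNReal.one_ne_top hδ1
  have hlogD : Real.log D ≤ 0 := Real.log_nonpos hD0.le hD1
  -- This `c` gives `D ^ (c * log (j + 1)) ≥ 1 / (j + 1)`.
  set c : ℝ := 1 / (1 - Real.log D) with hc
  have hc0 : 0 < c := by
    rw [hc]
    apply one_div_pos.2
    linarith
  have hc1 : c ≤ 1 := by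
    rw [hc, div_le_one (by linarith)]
    linarith
  have hcD : -1 ≤ c * Real.log D := by
    rw [hc, one_div_mul_eq_div, le_div_iff₀ (by linarith)]
    linarith
  set L : ℕ → ℕ := fun j => ⌈c * Real.log (j + 1)⌉₊ with hL
  have hlog0 : ∀ j : ℕ, 0 ≤ Real.log ((j : ℝ) + 1) := fun j => Real.log_nonneg (by simp)
  have hLle : ∀ j, L j ≤ j := fun j => by
    refine Nat.ceil_le.2 ?_
    have := Real.log_le_sub_one_of_pos (by positivity : (0 : ℝ) < j + 1)
    nlinarith [hlog0 j]
  set blk : ℕ → Finset ℕ := fun j => Finset.Ico ((j + 1) ^ 2) ((j + 1) ^ 2 + L j) with hblk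
  have hdisj : Pairwise (Function.onFun Disjoint blk) := by
    refine (pairwise_disjoint_on blk).2 fun i j hij => ?_
    refine Finset.disjoint_left.2 fun k hki hkj => ?_
    simp only [hblk, Finset.mem_Ico] at hki hkj
    have := hLle i
    nlinarith
  set W : ℕ → Set Ω := fun j => ⋂ k ∈ blk j, E k with hW
  have hWm : ∀ j, MeasurableSet (W j) := fun j => (blk j).measurableSet_biInter fun k _ => hEm k
  have hEprod := (iIndepSet_iff_meas_biInter hEm).1 hE
  have hWi : iIndepSet W P := by
    refine (iIndepSet_iff_meas_biInter hWm).2 fun S => ?_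
    simp only [hW]
    rw [← Finset.set_biInter_biUnion, hEprod, Finset.prod_biUnion fun i _ j _ hij => hdisj hij]
    exact Finset.prod_congr rfl fun i _ => (hEprod _).symm
  have hPW : ∀ j, P (W j) = δ ^ L j := fun j => by
    rw [hW, hEprod]
    simp [hPE, hblk]
  have hsum : ∑' j, P (W j) = ⊤ := by
    by_contra hne
    have hs := ENNReal.summable_toReal hne
    have hs' : Summable fun j : ℕ => D * (1 / ((j + 1 : ℕ) : ℝ)) := by
      refine hs.of_nonneg_of_le (fun j => by positivity) fun j => ?_
      rw [hPW, ENNReal.toReal_pow, ← hD]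
      have hj : (0 : ℝ) < j + 1 := by positivity
      calc D * (1 / ((j + 1 : ℕ) : ℝ))
          = Real.exp (Real.log D + -1 * Real.log (j + 1)) := by
            rw [Real.exp_add, Real.exp_log hD0, neg_one_mul, Real.exp_neg, Real.exp_log hj]
            simp
        _ ≤ Real.exp (L j * Real.log D) := by
            refine Real.exp_le_exp.2 ?_
            have h1 := (Nat.ceil_lt_add_one (mul_nonneg hc0.le (hlog0 j))).le
            have h2 := mul_le_mul_of_nonpos_right h1 hlogD
            have h3 := mul_le_mul_of_nonneg_right hcD (hlog0 j)
            simp only [hL]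
            nlinarith
        _ = D ^ L j := by rw [← Real.log_pow, Real.exp_log (by positivity)]
    have := (summable_nat_add_iff (f := fun j : ℕ => 1 / (j : ℝ)) 1).1
      ((summable_mul_left_iff hD0.ne').1 hs')
    exact Real.not_summable_one_div_natCast this
  have hlim := measure_limsup_eq_one hWm hWi hsum
  have hlim' : limsup W atTop ∈ ae P :=
    (mem_ae_iff_prob_eq_one (MeasurableSet.measurableSet_limsup hWm)).2 hlim
  filter_upwards [hlim'] with ω hω
  rw [mem_limsup_iff_frequently_mem] at hω
  have htend : Tendsto (fun j : ℕ => (j + 1) ^ 2) atTop atTop :=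
    (tendsto_pow_atTop two_ne_zero).comp (tendsto_add_atTop_nat 1)
  -- The constant is halved because `log ((j + 1) ^ 2) = 2 * log (j + 1)`.
  refine ⟨c / 2, by positivity, htend.frequently (hω.mono fun j hj k hk hk' => ?_)⟩
  refine mem_iInter₂.1 hj k (Finset.mem_Ico.2 ⟨hk, ?_⟩)
  have : k - (j + 1) ^ 2 < L j := by
    rw [hL, Nat.lt_ceil, Nat.cast_sub hk]
    push_cast at hk' ⊢
    rw [Real.log_pow] at hk'
    push_cast at hk'
    linarith
  omega

/-- Two independent i.i.d. sequences almost surely hit, simultaneously and along long runs, any two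
sets which they hit with positive probability. -/
theorem ae_hasLogRuns_preimage [IsProbabilityMeasure P] {β γ : Type*} [MeasurableSpace β]
    [MeasurableSpace γ]
    {Z : ℕ → Ω → β} {Y : ℕ → Ω → γ} (hZm : ∀ n, Measurable (Z n)) (hYm : ∀ n, Measurable (Y n))
    (hZ : iIndepFun Z P) (hY : iIndepFun Y P)
    (hZY : IndepFun (fun ω n => Z n ω) (fun ω n => Y n ω) P)
    (hZi : ∀ n, IdentDistrib (Z n) (Z 0) P P) (hYi : ∀ n, IdentDistrib (Y n) (Y 0) P P)
    {V : Set β} {U : Set γ} (hV : MeasurableSet V) (hU : MeasurableSet U)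
    (hV0 : ∃ᵐ ω ∂P, Z 0 ω ∈ V) (hU0 : ∃ᵐ ω ∂P, Y 0 ω ∈ U) :
    ∀ᵐ ω ∂P, HasLogRuns fun k => Z k ω ∈ V ∧ Y k ω ∈ U := by
  refine ae_hasLogRuns (E := fun n => Z n ⁻¹' V ∩ Y n ⁻¹' U)
    (δ := P (Z 0 ⁻¹' V) * P (Y 0 ⁻¹' U)) (fun n => (hZm n hV).inter (hYm n hU))
    (iIndepSet_preimage_inter_preimage hZm hYm hZ hY hZY hV hU) ?_ fun n => ?_
  · exact ENNReal.mul_pos (frequently_ae_iff.1 hV0) (frequently_ae_iff.1 hU0)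
  · have h : IndepFun (Z n) (Y n) P :=
      hZY.comp (measurable_pi_apply n) (measurable_pi_apply n)
    rw [h.measure_inter_preimage_eq_mul V U hV hU, (hZi n).measure_mem_eq hV,
      (hYi n).measure_mem_eq hU]

end Runs

/-! ### Dimensions of a Moran measure with typical data -/

theorem rpow_le_of_forall_rat {s w d : ℝ} (hs : 0 < s)
    (H : ∀ π lam : ℚ, w < π → 0 < lam → (lam : ℝ) < s → (lam : ℝ) ^ d ≤ π) : s ^ d ≤ w := by
  by_contra! hlt
  have hmem : {x : ℝ | w < x ^ d} ∈ 𝓝 s :=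
    (Real.continuousAt_rpow_const s d (Or.inl hs.ne')).eventually (lt_mem_nhds hlt)
  obtain ⟨l, hl, hsub⟩ := exists_Ioc_subset_of_mem_nhds hmem ⟨0, hs⟩
  obtain ⟨lam, h1, h2⟩ := exists_rat_btwn (max_lt hl hs)
  have h3 : w < (lam : ℝ) ^ d := hsub ⟨(le_max_left _ _).trans_lt h1, h2.le⟩
  obtain ⟨π, h4, h5⟩ := exists_rat_btwn h3
  exact (H π lam h4 (by exact_mod_cast (le_max_right l 0).trans_lt h1) h2).not_gt h5

theorem le_rpow_of_forall_rat {s w d : ℝ} (hs : 0 < s)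
    (H : ∀ π lam : ℚ, 0 < π → (π : ℝ) < w → s < lam → (π : ℝ) ≤ (lam : ℝ) ^ d) : w ≤ s ^ d := by
  by_contra! hlt
  have hmem : {x : ℝ | x ^ d < w} ∈ 𝓝 s :=
    (Real.continuousAt_rpow_const s d (Or.inl hs.ne')).eventually (gt_mem_nhds hlt)
  obtain ⟨u, hu, hsub⟩ := exists_Ico_subset_of_mem_nhds hmem ⟨s + 1, lt_add_one s⟩
  obtain ⟨lam, h1, h2⟩ := exists_rat_btwn hu
  have h3 : (lam : ℝ) ^ d < w := hsub ⟨h1.le, h2⟩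
  obtain ⟨π, h4, h5⟩ := exists_rat_btwn h3
  have hpos : (0 : ℝ) < π := (Real.rpow_nonneg (hs.trans h1).le d).trans_lt h4
  exact (H π lam (by exact_mod_cast hpos) h5 h1).not_gt h4

/-- Data of a Moran measure whose ratios of the child `c` lie in `[sI c, sS c]` and whose weights
lie in `[wI c, wS c]`, and which come close to the two relevant pairs of bounds simultaneously along
runs of logarithmic length. -/
structure TypicalData (A B : ℝ) (a b : ℕ → ℝ) (p : ℕ → unitInterval) (sI sS wI wS : Bool → ℝ) :
    Prop where
  ratios : MoranRatios A B a b
  weight_pos : ∀ c n, 0 < childWeight p c n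
  le_sI : ∀ c, A ≤ sI c
  sS_le : ∀ c, sS c ≤ B
  wI_nonneg : ∀ c, 0 ≤ wI c
  wS_le : ∀ c, wS c ≤ 1
  sI_le : ∀ c n, sI c ≤ childRatio a b c n
  le_sS : ∀ c n, childRatio a b c n ≤ sS c
  wI_le : ∀ c n, wI c ≤ childWeight p c n
  le_wS : ∀ c n, childWeight p c n ≤ wS c
  run_upper : ∀ c, ∀ π lam : ℚ, wI c < π → lam < sS c →
    HasLogRuns fun k => childWeight p c k ≤ π ∧ lam ≤ childRatio a b c k
  run_lower : ∀ c, ∀ π lam : ℚ, π < wS c → sI c < lam →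
    HasLogRuns fun k => π ≤ childWeight p c k ∧ childRatio a b c k ≤ lam

namespace TypicalData

variable {A B : ℝ} {a b : ℕ → ℝ} {p : ℕ → unitInterval} {sI sS wI wS : Bool → ℝ}
  (h : TypicalData A B a b p sI sS wI wS)

include h

theorem sI_pos (c : Bool) : 0 < sI c := h.ratios.pos.trans_le (h.le_sI c)

theorem sI_lt_one (c : Bool) : sI c < 1 :=
  ((h.sI_le c 0).trans (h.ratios.childRatio_le c 0)).trans_lt h.ratios.lt_one

theorem sS_pos (c : Bool) : 0 < sS c := (h.ratios.childRatio_pos c 0).trans_le (h.le_sS c 0)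

theorem sS_lt_one (c : Bool) : sS c < 1 := (h.sS_le c).trans_lt h.ratios.lt_one

theorem wI_lt_one (c : Bool) : wI c < 1 := by
  have h1 : childWeight p c 0 + childWeight p (!c) 0 = 1 := by cases c <;> simp [childWeight]
  linarith [h.wI_le c 0, h.weight_pos (!c) 0]

theorem wS_pos (c : Bool) : 0 < wS c := (h.weight_pos c 0).trans_le (h.le_wS c 0)

/-- The exponent is admissible since `ratio ^ d ≤ weight` holds at every step. -/
theorem upperPhiDim_le {Φ : ℝ → ℝ} {d : ℝ} (hd : ∀ c, Real.log (wI c) / Real.log (sS c) ≤ d)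
    (hw : ∀ c, 0 < wI c) : upperPhiDim Φ (moranMeasure a b p) ≤ d := by
  have hd0 : 0 ≤ d := (div_nonneg_of_nonpos (Real.log_nonpos (hw true).le (h.wI_lt_one true).le)
    (Real.log_nonpos (h.sS_pos true).le (h.sS_lt_one true).le)).trans (hd true)
  refine sInf_le ⟨d, ⟨1, one_pos, (1 / ((1 - B) * A)) ^ d, ?_, ?_⟩, rfl⟩
  · have := h.ratios.pos
    have := sub_pos.2 h.ratios.lt_one
    positivity
  · intro r R hr hrR hle _ hR1 x hx
    refine h.ratios.ball_div_ball_le h.weight_pos hd0 (fun c n => ?_) hr (hrR.le.trans hle) hR1.le hx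
    calc childRatio a b c n ^ d ≤ sS c ^ d :=
          Real.rpow_le_rpow (h.ratios.childRatio_pos c n).le (h.le_sS c n) hd0
      _ ≤ sS c ^ Real.logb (sS c) (wI c) :=
          Real.rpow_le_rpow_of_exponent_ge (h.sS_pos c) (h.sS_lt_one c).le (hd c)
      _ = wI c := Real.rpow_logb (h.sS_pos c) (h.sS_lt_one c).ne (hw c)
      _ ≤ _ := h.wI_le c n

/-- The exponent is admissible since `weight ≤ ratio ^ d` holds at every step. -/
theorem le_lowerPhiDim {Φ : ℝ → ℝ} {d : ℝ} (hd0 : 0 ≤ d)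
    (hd : ∀ c, d ≤ Real.log (wS c) / Real.log (sI c)) :
    d ≤ lowerPhiDim Φ (moranMeasure a b p) := by
  refine le_sSup ⟨d, ⟨1, one_pos, ((1 - B) * A) ^ d, ?_, ?_⟩, rfl⟩
  · have := h.ratios.pos
    have := sub_pos.2 h.ratios.lt_one
    positivity
  · intro r R hr hrR hle _ hR1 x hx
    refine h.ratios.le_ball_div_ball h.weight_pos hd0 (fun c n => ?_) hr (hrR.le.trans hle) hR1.le hx
    calc childWeight p c n ≤ wS c := h.le_wS c n
      _ = sI c ^ Real.logb (sI c) (wS c) :=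
          (Real.rpow_logb (h.sI_pos c) (h.sI_lt_one c).ne (h.wS_pos c)).symm
      _ ≤ sI c ^ d := Real.rpow_le_rpow_of_exponent_ge (h.sI_pos c) (h.sI_lt_one c).le (hd c)
      _ ≤ _ := Real.rpow_le_rpow (h.sI_pos c).le (h.sI_le c n) hd0

/-- Near-extremal runs force every admissible exponent of the upper dimension up to
`log (wI c) / log (sS c)`, and there is none if `wI c = 0`. -/
theorem admissible_upper {Φ : ℝ → ℝ} (hΦ : IsSmallDimensionFunction Φ) {d C₁ C₂ : ℝ}
    (hC₁ : 0 < C₁) (hC₂ : 0 < C₂)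
    (hadm : ∀ r R : ℝ, 0 < r → r < R ^ (1 + Φ R) → R ^ (1 + Φ R) ≤ R → R ≤ C₁ → R < 1 →
      ∀ x ∈ (moranMeasure a b p).support,
        moranMeasure a b p (Metric.ball x R) / moranMeasure a b p (Metric.ball x r) ≤
          ENNReal.ofReal (C₂ * (R / r) ^ d)) (c : Bool) :
    0 < wI c ∧ Real.log (wI c) / Real.log (sS c) ≤ d := by
  -- An admissible exponent stays admissible when it is increased, since `R / r ≥ 1`.
  have hle : sS c ^ max d 0 ≤ wI c := by
    refine rpow_le_of_forall_rat (h.sS_pos c) fun π lam h1 h2 h3 => ?_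
    refine h.ratios.le_of_run_of_upper h.weight_pos hΦ (le_max_right _ _) hC₁ (C₂ := C₂) ?_ c
      ((h.wI_nonneg c).trans_lt h1) (by exact_mod_cast h2) (h.run_upper c π lam h1 h3)
    intro r R hr hrR hRR hR1 hR2 x hx
    refine (hadm r R hr hrR hRR hR1 hR2 x hx).trans (ENNReal.ofReal_le_ofReal ?_)
    have : 1 ≤ R / r := (one_le_div hr).2 (hrR.le.trans hRR)
    gcongr
    exact le_max_left _ _
  have hw : 0 < wI c := (Real.rpow_pos_of_pos (h.sS_pos c) _).trans_le hle
  refine ⟨hw, ?_⟩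
  have hlog := Real.log_le_log (Real.rpow_pos_of_pos (h.sS_pos c) _) hle
  rw [Real.log_rpow (h.sS_pos c)] at hlog
  have hs := Real.log_neg (h.sS_pos c) (h.sS_lt_one c)
  have h1 := (div_le_iff_of_neg hs).2 hlog
  have h2 : 0 < Real.log (wI c) / Real.log (sS c) :=
    div_pos_of_neg_of_neg (Real.log_neg hw (h.wI_lt_one c)) hs
  exact (le_max_iff.1 h1).resolve_right (not_le.2 h2)

/-- Near-extremal runs bound every admissible exponent of the lower dimension by
`log (wS c) / log (sI c)`. -/
theorem lowerPhiDim_le {Φ : ℝ → ℝ} (hΦ : IsSmallDimensionFunction Φ) (c : Bool) :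
    lowerPhiDim Φ (moranMeasure a b p) ≤
      ((Real.log (wS c) / Real.log (sI c) : ℝ) : EReal) := by
  refine sSup_le ?_
  rintro _ ⟨d, ⟨C₁, hC₁, C₂, hC₂, hadm⟩, rfl⟩
  refine EReal.coe_le_coe_iff.2 ?_
  have hs := Real.log_neg (h.sI_pos c) (h.sI_lt_one c)
  rcases lt_or_ge d 0 with hd | hd
  · exact hd.le.trans (div_nonneg_of_nonpos (Real.log_nonpos (h.wS_pos c).le (h.wS_le c)) hs.le)
  have hle : wS c ≤ sI c ^ d := by
    refine le_rpow_of_forall_rat (h.sI_pos c) fun π lam h1 h2 h3 => ?_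
    exact h.ratios.le_of_run_of_lower h.weight_pos hΦ hd hC₁ hC₂ hadm c (by exact_mod_cast h1)
      ((h.sI_pos c).trans h3) (h.run_lower c π lam h2 h3)
  have hlog := Real.log_le_log (h.wS_pos c) hle
  rw [Real.log_rpow (h.sI_pos c)] at hlog
  exact (le_div_iff_of_neg hs).2 hlog

theorem upperPhiDim_eq {Φ : ℝ → ℝ} (hΦ : IsSmallDimensionFunction Φ) :
    upperPhiDim Φ (moranMeasure a b p) = if wI false = 0 ∨ wI true = 0 then ⊤ else
      ((max (Real.log (wI false) / Real.log (sS false))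
        (Real.log (wI true) / Real.log (sS true)) : ℝ) : EReal) := by
  split_ifs with h0
  · refine sInf_eq_top.2 ?_
    rintro _ ⟨d, ⟨C₁, hC₁, C₂, hC₂, hadm⟩, rfl⟩
    have := fun c => (h.admissible_upper hΦ hC₁ hC₂ hadm c).1.ne'
    exact absurd h0 (by simp [this])
  · push Not at h0
    refine le_antisymm (h.upperPhiDim_le (fun c => ?_) fun c => ?_) (le_sInf ?_)
    · cases c
      · exact le_max_left _ _
      · exact le_max_right _ _
    · refine (h.wI_nonneg c).lt_of_ne' ?_
      cases c
      · exact h0.1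
      · exact h0.2
    · rintro _ ⟨d, ⟨C₁, hC₁, C₂, hC₂, hadm⟩, rfl⟩
      have := fun c => (h.admissible_upper hΦ hC₁ hC₂ hadm c).2
      exact EReal.coe_le_coe_iff.2 (max_le (this _) (this _))

theorem lowerPhiDim_eq {Φ : ℝ → ℝ} (hΦ : IsSmallDimensionFunction Φ) :
    lowerPhiDim Φ (moranMeasure a b p) =
      ((min (Real.log (wS false) / Real.log (sI false))
        (Real.log (wS true) / Real.log (sI true)) : ℝ) : EReal) := by
  refine le_antisymm ?_ (h.le_lowerPhiDim (le_min ?_ ?_) fun c => ?_)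
  · rcases min_choice (Real.log (wS false) / Real.log (sI false))
        (Real.log (wS true) / Real.log (sI true)) with e | e <;> rw [e]
    · exact h.lowerPhiDim_le hΦ false
    · exact h.lowerPhiDim_le hΦ true
  · exact div_nonneg_of_nonpos (Real.log_nonpos (h.wS_pos _).le (h.wS_le _))
      (Real.log_nonpos (h.sI_pos _).le (h.sI_lt_one _).le)
  · exact div_nonneg_of_nonpos (Real.log_nonpos (h.wS_pos _).le (h.wS_le _))
      (Real.log_nonpos (h.sI_pos _).le (h.sI_lt_one _).le)
  · cases c
    · exact min_le_left _ _
    · exact min_le_right _ _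

end TypicalData

/-! ### Almost every realization is typical -/

section Typical

variable {Ω : Type*} [MeasurableSpace Ω] {P : Measure Ω}

theorem ae_forall_of_identDistrib {β : Type*} [MeasurableSpace β] {Z : ℕ → Ω → β}
    (hZi : ∀ n, IdentDistrib (Z n) (Z 0) P P) {T : β → Prop} (hT : MeasurableSet {z | T z})
    (h0 : ∀ᵐ ω ∂P, T (Z 0 ω)) : ∀ᵐ ω ∂P, ∀ n, T (Z n ω) :=
  ae_all_iff.2 fun n => (hZi n).symm.ae_snd hT h0

/-- A finite negative moment excludes the value `0`, where `0 ^ (-t) = ⊤`. -/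
theorem ae_pos_of_lintegral_rpow_neg {f : Ω → ℝ} (hf : Measurable f) {t : ℝ} (ht : 0 < t)
    (hfin : ∫⁻ ω, ENNReal.ofReal (f ω) ^ (-t) ∂P < ⊤) : ∀ᵐ ω ∂P, 0 < f ω := by
  filter_upwards [ae_lt_top (hf.ennreal_ofReal.pow_const (-t)) hfin.ne] with ω hω
  by_contra! hle
  rw [ENNReal.ofReal_of_nonpos hle, ENNReal.zero_rpow_of_neg (neg_neg_of_pos ht)] at hω
  exact lt_irrefl _ hω

theorem essInf_facts [IsProbabilityMeasure P] {f : Ω → ℝ} {l u : ℝ}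
    (hl : ∀ ω, l ≤ f ω) (hu : ∀ ω, f ω ≤ u) :
    l ≤ essInf f P ∧ (∀ᵐ ω ∂P, essInf f P ≤ f ω) ∧ ∀ x, essInf f P < x → ∃ᵐ ω ∂P, f ω < x := by
  have hb : IsBoundedUnder (· ≥ ·) (ae P) f := isBoundedUnder_of ⟨l, hl⟩
  have hc : IsCoboundedUnder (· ≥ ·) (ae P) f :=
    (isBoundedUnder_of ⟨u, hu⟩ : IsBoundedUnder (· ≤ ·) (ae P) f).isCoboundedUnder_ge
  exact ⟨le_liminf_of_le hc (Eventually.of_forall hl), ae_essInf_le hb,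
    fun x hx => frequently_lt_of_liminf_lt hc hx⟩

theorem essSup_facts [IsProbabilityMeasure P] {f : Ω → ℝ} {l u : ℝ}
    (hl : ∀ ω, l ≤ f ω) (hu : ∀ ω, f ω ≤ u) :
    essSup f P ≤ u ∧ (∀ᵐ ω ∂P, f ω ≤ essSup f P) ∧ ∀ x, x < essSup f P → ∃ᵐ ω ∂P, x < f ω := by
  have hb : IsBoundedUnder (· ≤ ·) (ae P) f := isBoundedUnder_of ⟨u, hu⟩
  have hc : IsCoboundedUnder (· ≤ ·) (ae P) f :=
    (isBoundedUnder_of ⟨l, hl⟩ : IsBoundedUnder (· ≥ ·) (ae P) f).isCoboundedUnder_le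
  exact ⟨limsup_le_of_le hc (Eventually.of_forall hu), ae_le_essSup hb,
    fun x hx => frequently_lt_of_lt_limsup hc hx⟩

/-- The ratio of the child `c` as a function of the pair `z` of ratios of one step, see
`childRatio`. -/
def ratioOf (c : Bool) (z : ℝ × ℝ) : ℝ := if c then z.2 else z.1

/-- The weight of the child `c` as a function of the weight `q` of the left child, see
`childWeight`. -/
def weightOf (c : Bool) (q : unitInterval) : ℝ := if c then 1 - (q : ℝ) else q

theorem measurable_ratioOf (c : Bool) : Measurable (ratioOf c) := by
  cases c
  · exact measurable_fst
  · exact measurable_snd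

theorem measurable_weightOf (c : Bool) : Measurable (weightOf c) := by
  cases c
  · exact measurable_subtype_coe
  · exact measurable_const.sub measurable_subtype_coe

/-- The bounds hold almost surely at all steps because the data are identically distributed. Each of
the countably many kinds of runs with rational thresholds occurs almost surely, since the ratios and
the weights are independent of each other. -/
theorem ae_typicalData [IsProbabilityMeasure P] {A B : ℝ} (hA : 0 < A) (hB : B < 1)
    {a b : ℕ → Ω → ℝ} {p : ℕ → Ω → unitInterval}
    (ha_meas : ∀ n, Measurable (a n)) (hb_meas : ∀ n, Measurable (b n))
    (hp_meas : ∀ n, Measurable (p n))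
    (haA : ∀ n ω, A ≤ a n ω) (hbA : ∀ n ω, A ≤ b n ω) (habB : ∀ n ω, a n ω + b n ω ≤ B)
    (hab_indep : iIndepFun (fun n ω => (a n ω, b n ω)) P)
    (hab_ident : ∀ n, IdentDistrib (fun ω => (a n ω, b n ω)) (fun ω => (a 0 ω, b 0 ω)) P P)
    (hp_indep : iIndepFun p P) (hp_ident : ∀ n, IdentDistrib (p n) (p 0) P P)
    (habp_indep : IndepFun (fun ω n => (a n ω, b n ω)) (fun ω n => p n ω) P)
    (hw_pos : ∀ c, ∀ᵐ ω ∂P, 0 < weightOf c (p 0 ω)) :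
    ∀ᵐ ω ∂P, TypicalData A B (fun n => a n ω) (fun n => b n ω) (fun n => p n ω)
      (fun c => essInf (fun ω => ratioOf c (a 0 ω, b 0 ω)) P)
      (fun c => essSup (fun ω => ratioOf c (a 0 ω, b 0 ω)) P)
      (fun c => essInf (fun ω => weightOf c (p 0 ω)) P)
      (fun c => essSup (fun ω => weightOf c (p 0 ω)) P) := by
  have hratios : ∀ ω, MoranRatios A B (fun n => a n ω) (fun n => b n ω) := fun ω =>
    ⟨hA, hB, fun n => haA n ω, fun n => hbA n ω, fun n => habB n ω⟩
  have hs0 : ∀ c ω, A ≤ ratioOf c (a 0 ω, b 0 ω) := fun c ω => (hratios ω).le_childRatio c 0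
  have hs1 : ∀ c ω, ratioOf c (a 0 ω, b 0 ω) ≤ B := fun c ω => (hratios ω).childRatio_le c 0
  have hw0 : ∀ c ω, 0 ≤ weightOf c (p 0 ω) := fun c ω => by
    cases c
    · exact (p 0 ω).2.1
    · exact sub_nonneg.2 (p 0 ω).2.2
  have hw1 : ∀ c ω, weightOf c (p 0 ω) ≤ 1 := fun c ω => by
    cases c
    · exact (p 0 ω).2.2
    · exact sub_le_self _ (p 0 ω).2.1
  have hsI := fun c => essInf_facts (P := P) (hs0 c) (hs1 c)
  have hsS := fun c => essSup_facts (P := P) (hs0 c) (hs1 c)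
  have hwI := fun c => essInf_facts (P := P) (hw0 c) (hw1 c)
  have hwS := fun c => essSup_facts (P := P) (hw0 c) (hw1 c)
  have hab_meas : ∀ n, Measurable fun ω => (a n ω, b n ω) :=
    fun n => (ha_meas n).prodMk (hb_meas n)
  have e1 : ∀ᵐ ω ∂P, ∀ c n, 0 < weightOf c (p n ω) := ae_all_iff.2 fun c =>
    ae_forall_of_identDistrib hp_ident (T := fun q => 0 < weightOf c q)
      (measurableSet_lt measurable_const (measurable_weightOf c)) (hw_pos c)
  have e2 : ∀ᵐ ω ∂P, ∀ c n, essInf (fun ω => ratioOf c (a 0 ω, b 0 ω)) P ≤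
      ratioOf c (a n ω, b n ω) := ae_all_iff.2 fun c =>
    ae_forall_of_identDistrib hab_ident (T := fun z => _ ≤ ratioOf c z)
      (measurableSet_le measurable_const (measurable_ratioOf c)) (hsI c).2.1
  have e3 : ∀ᵐ ω ∂P, ∀ c n, ratioOf c (a n ω, b n ω) ≤
      essSup (fun ω => ratioOf c (a 0 ω, b 0 ω)) P := ae_all_iff.2 fun c =>
    ae_forall_of_identDistrib hab_ident (T := fun z => ratioOf c z ≤ _)
      (measurableSet_le (measurable_ratioOf c) measurable_const) (hsS c).2.1
  have e4 : ∀ᵐ ω ∂P, ∀ c n, essInf (fun ω => weightOf c (p 0 ω)) P ≤ weightOf c (p n ω) :=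
    ae_all_iff.2 fun c => ae_forall_of_identDistrib hp_ident (T := fun q => _ ≤ weightOf c q)
      (measurableSet_le measurable_const (measurable_weightOf c)) (hwI c).2.1
  have e5 : ∀ᵐ ω ∂P, ∀ c n, weightOf c (p n ω) ≤ essSup (fun ω => weightOf c (p 0 ω)) P :=
    ae_all_iff.2 fun c => ae_forall_of_identDistrib hp_ident (T := fun q => weightOf c q ≤ _)
      (measurableSet_le (measurable_weightOf c) measurable_const) (hwS c).2.1
  have e6 : ∀ᵐ ω ∂P, ∀ c, ∀ π lam : ℚ, essInf (fun ω => weightOf c (p 0 ω)) P < π →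
      lam < essSup (fun ω => ratioOf c (a 0 ω, b 0 ω)) P →
      HasLogRuns fun k => (a k ω, b k ω) ∈ ratioOf c ⁻¹' Ici (lam : ℝ) ∧
        p k ω ∈ weightOf c ⁻¹' Iic (π : ℝ) := by
    simp only [ae_all_iff]
    intro c π lam hπ hlam
    exact ae_hasLogRuns_preimage hab_meas hp_meas hab_indep hp_indep habp_indep hab_ident hp_ident
      (measurable_ratioOf c measurableSet_Ici) (measurable_weightOf c measurableSet_Iic)
      (((hsS c).2.2 _ hlam).mono fun _ => le_of_lt) (((hwI c).2.2 _ hπ).mono fun _ => le_of_lt)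
  have e7 : ∀ᵐ ω ∂P, ∀ c, ∀ π lam : ℚ, π < essSup (fun ω => weightOf c (p 0 ω)) P →
      essInf (fun ω => ratioOf c (a 0 ω, b 0 ω)) P < lam →
      HasLogRuns fun k => (a k ω, b k ω) ∈ ratioOf c ⁻¹' Iic (lam : ℝ) ∧
        p k ω ∈ weightOf c ⁻¹' Ici (π : ℝ) := by
    simp only [ae_all_iff]
    intro c π lam hπ hlam
    exact ae_hasLogRuns_preimage hab_meas hp_meas hab_indep hp_indep habp_indep hab_ident hp_ident
      (measurable_ratioOf c measurableSet_Iic) (measurable_weightOf c measurableSet_Ici)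
      (((hsI c).2.2 _ hlam).mono fun _ => le_of_lt) (((hwS c).2.2 _ hπ).mono fun _ => le_of_lt)
  filter_upwards [e1, e2, e3, e4, e5, e6, e7] with ω h1 h2 h3 h4 h5 h6 h7
  exact
    { ratios := hratios ω
      weight_pos := h1
      le_sI := fun c => (hsI c).1
      sS_le := fun c => (hsS c).1
      wI_nonneg := fun c => (hwI c).1
      wS_le := fun c => (hwS c).1
      sI_le := h2
      le_sS := h3
      wI_le := h4
      le_wS := h5
      run_upper := fun c π lam hπ hlam => (h6 c π lam hπ hlam).mono fun _ hk => hk.symm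
      run_lower := fun c π lam hπ hlam => (h7 c π lam hπ hlam).mono fun _ hk => hk.symm }

end Typical

theorem mainTheorem2 {Ω : Type*} [MeasurableSpace Ω] (P : Measure Ω) [IsProbabilityMeasure P]
    (A B : ℝ) (hA : 0 < A) (hAB : A < B) (hB : B < 1)
    (a b : ℕ → Ω → ℝ) (p : ℕ → Ω → unitInterval)
    (ha_meas : ∀ n, Measurable (a n)) (hb_meas : ∀ n, Measurable (b n))
    (hp_meas : ∀ n, Measurable (p n))
    (haA : ∀ n ω, A ≤ a n ω) (hbA : ∀ n ω, A ≤ b n ω) (habB : ∀ n ω, a n ω + b n ω ≤ B)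
    (hab_indep : iIndepFun (fun n ω => (a n ω, b n ω)) P)
    (hab_ident : ∀ n, IdentDistrib (fun ω => (a n ω, b n ω)) (fun ω => (a 0 ω, b 0 ω)) P P)
    (hp_indep : iIndepFun p P)
    (hp_ident : ∀ n, IdentDistrib (p n) (p 0) P P)
    (habp_indep : IndepFun (fun ω n => (a n ω, b n ω)) (fun ω n => p n ω) P)
    (ha_mom : ∃ t : ℝ, 0 < t ∧ ∀ n, ∫⁻ ω, ENNReal.ofReal (a n ω) ^ (-t) ∂P < ⊤)
    (hb_mom : ∃ t : ℝ, 0 < t ∧ ∀ n, ∫⁻ ω, ENNReal.ofReal (b n ω) ^ (-t) ∂P < ⊤)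
    (hp_mom : ∃ t : ℝ, 0 < t ∧ ∀ n, ∫⁻ ω, ENNReal.ofReal (p n ω) ^ (-t) ∂P < ⊤)
    (hq_mom : ∃ t : ℝ, 0 < t ∧ ∀ n, ∫⁻ ω, ENNReal.ofReal (1 - p n ω) ^ (-t) ∂P < ⊤)
    (a₀ b₀ A₀ B₀ p₀ q₀ P₀ Q₀ : ℝ)
    (ha₀ : a₀ = essInf (a 0) P) (hb₀ : b₀ = essInf (b 0) P)
    (hA₀ : A₀ = essSup (a 0) P) (hB₀ : B₀ = essSup (b 0) P)
    (hp₀ : p₀ = essSup (fun ω => (p 0 ω : ℝ)) P) (hq₀ : q₀ = essSup (fun ω => 1 - (p 0 ω : ℝ)) P)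
    (hP₀ : P₀ = essInf (fun ω => (p 0 ω : ℝ)) P) (hQ₀ : Q₀ = essInf (fun ω => 1 - (p 0 ω : ℝ)) P)
    (α β : EReal)
    (hα : α = if P₀ = 0 ∨ Q₀ = 0 then ⊤ else
      ((max (Real.log P₀ / Real.log A₀) (Real.log Q₀ / Real.log B₀) : ℝ) : EReal))
    (hβ : β = ((min (Real.log p₀ / Real.log a₀) (Real.log q₀ / Real.log b₀) : ℝ) : EReal)) :
    ∃ Γ : Set Ω, MeasurableSet Γ ∧ P Γ = 1 ∧ ∀ ω ∈ Γ, ∀ Φ : ℝ → ℝ, IsSmallDimensionFunction Φ →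
      upperPhiDim Φ (moranMeasure (fun n => a n ω) (fun n => b n ω) (fun n => p n ω)) = α ∧
      lowerPhiDim Φ (moranMeasure (fun n => a n ω) (fun n => b n ω) (fun n => p n ω)) = β := by
  obtain ⟨t₁, ht₁, hpt⟩ := hp_mom
  obtain ⟨t₂, ht₂, hqt⟩ := hq_mom
  have hp0 : Measurable fun ω => (p 0 ω : ℝ) := measurable_subtype_coe.comp (hp_meas 0)
  have hw_pos : ∀ c, ∀ᵐ ω ∂P, 0 < weightOf c (p 0 ω) := fun c => by
    cases c
    · exact ae_pos_of_lintegral_rpow_neg hp0 ht₁ (hpt 0)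
    · exact ae_pos_of_lintegral_rpow_neg (measurable_const.sub hp0) ht₂ (hqt 0)
  have hae := ae_typicalData hA hB ha_meas hb_meas hp_meas haA hbA habB hab_indep hab_ident hp_indep
    hp_ident habp_indep hw_pos
  obtain ⟨Γ, hΓ1, hΓm, hΓ⟩ := hae.exists_measurable_mem
  subst hα hβ ha₀ hb₀ hA₀ hB₀ hp₀ hq₀ hP₀ hQ₀
  exact ⟨Γ, hΓm, (mem_ae_iff_prob_eq_one hΓm).1 hΓ1, fun ω hω Φ hΦ =>
    ⟨(hΓ ω hω).upperPhiDim_eq hΦ, (hΓ ω hω).lowerPhiDim_eq hΦ⟩⟩
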